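/- Let $N\cong\mathbb Z^r$ be a free $\mathbb Z$-module of finite rank with dual $M=\operatorname{Hom}(N,\mathbb Z)$, let $\Delta$ be a finite (not necessarily complete) smooth fan in $N_{\mathbb R}$, and let $X$ be the corresponding toric variety over $\mathbb C$, with torus $T=\operatorname{Spec}\mathbb C[M]\subseteq X$, whose identity element is denoted $1\in T$, and with characters $\mathbf e(m)$, $m\in M$. Let $\Delta(1)$ be the set of one-dimensional cones of $\Delta$; for $\rho\in\Delta(1)$ let $n(\rho)\in N$ be its primitive generator and $V(\rho)=\overline{\operatorname{orb}\rho}\subset X$ the corresponding prime divisor. Let $Y$ be a normal algebraic variety over $\mathbb C$ (irreducible) and let $y_0$ be a point of $Y$. Then the set of morphisms $f:Y\to X$ over $\mathbb C$ with $f(y_0)=1\in T$ is in one-to-one correspondence with the set of pairs $(\{D(\rho)\}_{\rho\in\Delta(1)},\varepsilon)$ consisting of effective Weil divisors $D(\rho)$ on $Y$ such that $$D(\rho_1)\cap\cdots\cap D(\rho_s)=\emptyset\quad\text{whenever}\quad \rho_1+\cdots+\rho_s\notin\Delta$$ (the intersection being that of the supports), and a group homomorphism $$\varepsilon: M\to H^0\Bigl(Y\setminus\textstyle\bigcup_{\rho\in\Delta(1)}D(\rho),\mathcal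 O_Y\Bigr)^{\times}$$ such that $$\operatorname{div}(\varepsilon(m))=\sum_{\rho\in\Delta(1)}\langle m,n(\rho)\rangle D(\rho)\quad\text{for all } m\in M,$$ and such that $y_0\notin\bigcup_\rho D(\rho)$ and $\varepsilon(m)$ has the value $1$ at $y_0$ for all $m\in M$. The correspondence sends $f$ to the pair in which $D(\rho)=f^{-1}(V(\rho))$ is the pull-back Weil divisor, so that $f^{-1}(T)=Y\setminus\bigcup_\rho D(\rho)$, and $\varepsilon(m)=f^*\mathbf e(m)$. -/

import Mathlib

open CategoryTheory CategoryTheory.Limits AlgebraicGeometry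
open scoped TensorProduct

noncomputable section

namespace SmoothToric

section Cones

variable {N : Type} [AddCommGroup N]

/-- The real extension of `m : N → ℤ`, i.e. the pairing `⟨m, ·⟩ : N_ℝ → ℝ`. -/
def pairing (m : Module.Dual ℤ N) : (ℝ ⊗[ℤ] N) →ₗ[ℝ] ℝ :=
  Module.Dual.baseChange ℝ m

@[simp] lemma pairing_tmul (m : Module.Dual ℤ N) (r : ℝ) (n : N) :
    pairing m (r ⊗ₜ[ℤ] n) = (m n : ℝ) * r := by
  simp [pairing]

lemma pairing_add (m m' : Module.Dual ℤ N) : pairing (m + m') = pairing m + pairing m' := by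
  simp [pairing]

lemma pairing_zero : pairing (0 : Module.Dual ℤ N) = 0 := by
  simp [pairing]

/-- The cone in `N_ℝ` generated by a set of lattice vectors. -/
def latticeCone (S : Set N) : PointedCone ℝ (ℝ ⊗[ℤ] N) :=
  PointedCone.hull ℝ ((fun n : N => (1 : ℝ) ⊗ₜ[ℤ] n) '' S)

/-- A cone is smooth if it is generated by a part of a `ℤ`-basis of the lattice. -/
def IsSmoothCone (σ : PointedCone ℝ (ℝ ⊗[ℤ] N)) : Prop :=
  ∃ (b : Module.Basis (Fin (Module.finrank ℤ N)) ℤ N) (s : Set (Fin (Module.finrank ℤ N))),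
    σ = latticeCone (b '' s)

/-- The monoid `M ∩ σ^∨`, where `M` is the dual lattice of `N`. -/
def dualMonoid (σ : PointedCone ℝ (ℝ ⊗[ℤ] N)) : AddSubmonoid (Module.Dual ℤ N) where
  carrier := {m | ∀ v ∈ σ, 0 ≤ pairing m v}
  zero_mem' := by simp [pairing_zero]
  add_mem' := fun {a b} ha hb v hv => by
    simpa [pairing_add] using add_nonneg (ha v hv) (hb v hv)

lemma dualMonoid_anti {τ σ : PointedCone ℝ (ℝ ⊗[ℤ] N)} (h : τ ≤ σ) :
    dualMonoid σ ≤ dualMonoid τ := fun _ hm v hv => hm v (h hv)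

lemma mem_dualMonoid_bot (m : Module.Dual ℤ N) :
    m ∈ dualMonoid (⊥ : PointedCone ℝ (ℝ ⊗[ℤ] N)) := by
  intro v hv
  rw [(Submodule.mem_bot _).1 hv]
  simp

lemma nonneg_of_latticeCone {S : Set N} {m : Module.Dual ℤ N} (h : ∀ n ∈ S, 0 ≤ m n) :
    m ∈ dualMonoid (latticeCone S) := by
  intro v hv
  induction hv using Submodule.span_induction with
  | mem x hx =>
    obtain ⟨n, hn, rfl⟩ := hx
    simpa using h n hn
  | zero => simp
  | add x y _ _ hx hy => simpa using add_nonneg hx hy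
  | smul a x _ hx =>
    have : pairing m (a • x) = a.1 * pairing m x := by
      rw [← smul_eq_mul, ← map_smul]; rfl
    rw [this]
    exact mul_nonneg a.2 hx

lemma tmul_mem_latticeCone {S : Set N} {n : N} (h : n ∈ S) :
    (1 : ℝ) ⊗ₜ[ℤ] n ∈ latticeCone S :=
  Submodule.subset_span ⟨n, h, rfl⟩

/-- Faces of smooth cones are cut out by lattice functionals. -/
lemma exists_supporting {σ τ : PointedCone ℝ (ℝ ⊗[ℤ] N)} (hσ : IsSmoothCone σ)
    (hτ : τ.IsFaceOf σ) :
    ∃ m ∈ dualMonoid σ, ∀ v, v ∈ τ ↔ v ∈ σ ∧ pairing m v = 0 := by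
  classical
  obtain ⟨b, s, rfl⟩ := hσ
  let m : Module.Dual ℤ N :=
    ∑ i, if i ∈ s ∧ (1 : ℝ) ⊗ₜ[ℤ] b i ∉ τ then b.coord i else 0
  have hm : ∀ i, m (b i) = if i ∈ s ∧ (1 : ℝ) ⊗ₜ[ℤ] b i ∉ τ then 1 else 0 := by
    intro i
    simp only [m, LinearMap.sum_apply]
    rw [Finset.sum_eq_single i]
    · split_ifs <;> simp
    · intro j _ hj
      split_ifs <;> simp [Finsupp.single_eq_of_ne hj]
    · simp
  have hm0 : m ∈ dualMonoid (latticeCone (b '' s)) := by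
    refine nonneg_of_latticeCone ?_
    rintro _ ⟨i, -, rfl⟩
    rw [hm]; split_ifs <;> simp
  refine ⟨m, hm0, fun v => ⟨fun hv => ⟨hτ.le hv, ?_⟩, fun ⟨hv, hv0⟩ => ?_⟩⟩
  · -- on the face the functional vanishes
    have key : ∀ w ∈ latticeCone (b '' s), w ∈ τ → pairing m w = 0 := by
      intro w hw
      induction hw using Submodule.span_induction with
      | mem x hx =>
        obtain ⟨_, ⟨i, hi, rfl⟩, rfl⟩ := hx
        intro h
        simp [hm, h]
      | zero => simp
      | add x y hx hy ihx ihy =>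
        intro h
        rw [map_add, ihx (hτ.mem_of_add_mem_left hx hy h), ihy (hτ.mem_of_add_mem_right hx hy h),
          add_zero]
      | smul a x hx ih =>
        intro h
        have e : pairing m (a • x) = a.1 * pairing m x := by
          rw [← smul_eq_mul, ← map_smul]; rfl
        rcases eq_or_lt_of_le a.2 with h0 | h0
        · rw [e, ← h0, zero_mul]
        · rw [e, ih, mul_zero]
          refine hτ.mem_of_smul_add_mem (y := 0) (a := a.1) hx (zero_mem _) h0 ?_
          rw [add_zero]; exact h
    exact key v (hτ.le hv) hv
  · have key : ∀ w ∈ latticeCone (b '' s), pairing m w = 0 → w ∈ τ := by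
      intro w hw
      induction hw using Submodule.span_induction with
      | mem x hx =>
        obtain ⟨_, ⟨i, hi, rfl⟩, rfl⟩ := hx
        intro h
        by_contra hc
        simp [hm, hc, hi] at h
      | zero => simp
      | add x y hx hy ihx ihy =>
        intro h
        rw [map_add] at h
        have hx' := hm0 x hx
        have hy' := hm0 y hy
        exact add_mem (ihx (by linarith)) (ihy (by linarith))
      | smul a x hx ih =>
        intro h
        have e : pairing m (a • x) = a.1 * pairing m x := by
          rw [← smul_eq_mul, ← map_smul]; rfl
        rcases eq_or_lt_of_le a.2 with h0 | h0
        · have : a = 0 := Subtype.ext h0.symm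
          rw [this, zero_smul]; exact zero_mem _
        · rw [e] at h
          exact Submodule.smul_mem _ _ (ih ((mul_eq_zero.1 h).resolve_left h0.ne'))
    exact key v hv hv0

/-- A functional nonnegative on a face becomes nonnegative on the whole cone after adding
a multiple of a functional cutting out the face. -/
lemma exists_add_nsmul_mem {σ τ : PointedCone ℝ (ℝ ⊗[ℤ] N)} (hσ : IsSmoothCone σ)
    {m : Module.Dual ℤ N} (hm : m ∈ dualMonoid σ)
    (hτ : ∀ v, v ∈ τ ↔ v ∈ σ ∧ pairing m v = 0) {u : Module.Dual ℤ N} (hu : u ∈ dualMonoid τ) :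
    ∃ k : ℕ, u + k • m ∈ dualMonoid σ := by
  obtain ⟨b, s, rfl⟩ := hσ
  refine ⟨∑ i, (u (b i)).natAbs, nonneg_of_latticeCone ?_⟩
  rintro _ ⟨i, hi, rfl⟩
  have hmem := tmul_mem_latticeCone (S := b '' s) ⟨i, hi, rfl⟩
  have h1 := hm _ hmem
  simp only [pairing_tmul, mul_one, Int.cast_nonneg_iff] at h1
  rcases eq_or_lt_of_le h1 with h0 | h0
  · have h2 := hu _ ((hτ _).2 ⟨hmem, by simp [← h0]⟩)
    simp only [pairing_tmul, mul_one, Int.cast_nonneg_iff] at h2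
    simpa [← h0] using h2
  · have h3 : (u (b i)).natAbs ≤ ∑ i, (u (b i)).natAbs :=
      Finset.single_le_sum (f := fun i => (u (b i)).natAbs) (fun _ _ => Nat.zero_le _)
        (Finset.mem_univ i)
    have h4 : ((∑ i, (u (b i)).natAbs : ℕ) : ℤ) ≤ (∑ i, (u (b i)).natAbs : ℕ) * m (b i) :=
      le_mul_of_one_le_right (by positivity) h0
    have h5 : 0 ≤ u (b i) + ((∑ i, (u (b i)).natAbs : ℕ) : ℤ) := by omega
    simp only [LinearMap.add_apply, LinearMap.smul_apply, nsmul_eq_mul]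
    linarith

/-- A vector of a lattice is primitive if it is nonzero and not a proper multiple of
another lattice vector. -/
def IsPrimitive (n : N) : Prop :=
  n ≠ 0 ∧ ∀ (k : ℤ) (n' : N), n = k • n' → IsUnit k

/-- A smooth cone whose linear span is a line is the ray through a primitive vector. -/
lemma exists_primitive {σ : PointedCone ℝ (ℝ ⊗[ℤ] N)} (hσ : IsSmoothCone σ)
    (h1 : Module.finrank ℝ (Submodule.span ℝ (σ : Set (ℝ ⊗[ℤ] N))) = 1) :
    ∃ n : N, IsPrimitive n ∧ σ = latticeCone {n} := by
  classical
  obtain ⟨b, s, rfl⟩ := hσ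
  let B := Algebra.TensorProduct.basis ℝ b
  have hB : ∀ i, B i = (1 : ℝ) ⊗ₜ[ℤ] b i := fun i => by simp [B]
  have hspan : Submodule.span ℝ (latticeCone (b '' s) : Set (ℝ ⊗[ℤ] N))
      = Submodule.span ℝ (Set.range fun i : s => B i) := by
    apply le_antisymm
    · refine Submodule.span_le.2 fun v hv => ?_
      refine PointedCone.hull_le_span (R := ℝ) _ ?_ |> fun h => h
      have : ((fun n : N => (1 : ℝ) ⊗ₜ[ℤ] n) '' (b '' s)) = Set.range fun i : s => B i := by
        ext x; simp [hB]
      rw [← this]; exact hv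
    · refine Submodule.span_mono ?_
      rintro _ ⟨i, rfl⟩
      simp only [hB]
      exact tmul_mem_latticeCone ⟨i, i.2, rfl⟩
  have hli : LinearIndependent ℝ (fun i : s => B i) :=
    B.linearIndependent.comp _ Subtype.val_injective
  rw [hspan, finrank_span_eq_card hli,
    Fintype.card_eq_one_iff] at h1
  obtain ⟨i, hi⟩ := h1
  have hs : s = {i.1} := by
    ext j; constructor
    · intro hj; exact congrArg Subtype.val (hi ⟨j, hj⟩)
    · rintro rfl; exact i.2
  refine ⟨b i, ⟨b.ne_zero _, fun k n' hk => ?_⟩, (congrArg (fun t => latticeCone (b '' t)) hs).trans (by rw [Set.image_singleton])⟩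
  have := congrArg (fun x => b.coord i.1 x) hk
  simp only [Module.Basis.coord_apply, Module.Basis.repr_self, Finsupp.single_eq_same, map_smul, smul_eq_mul] at this
  exact IsUnit.of_mul_eq_one _ this.symm

end Cones

section Rings

variable {N : Type} [AddCommGroup N]

/-- The coordinate ring `ℂ[M ∩ σ^∨]` of the affine toric variety of the cone `σ`. -/
abbrev coneRing (σ : PointedCone ℝ (ℝ ⊗[ℤ] N)) : Type := AddMonoidAlgebra ℂ (dualMonoid σ)

/-- The character `e(m)`, as an element of `ℂ[M ∩ σ^∨]`. -/
def character {σ : PointedCone ℝ (ℝ ⊗[ℤ] N)} (m : dualMonoid σ) : coneRing σ :=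
  AddMonoidAlgebra.single m 1

/-- The inclusion `ℂ[M ∩ σ^∨] → ℂ[M ∩ τ^∨]` for `τ ⊆ σ`. -/
def coneRingMap {τ σ : PointedCone ℝ (ℝ ⊗[ℤ] N)} (h : τ ≤ σ) : coneRing σ →+* coneRing τ :=
  AddMonoidAlgebra.mapDomainRingHom ℂ (AddSubmonoid.inclusion (dualMonoid_anti h))

lemma coneRingMap_single {τ σ : PointedCone ℝ (ℝ ⊗[ℤ] N)} (h : τ ≤ σ) (m : dualMonoid σ) (c : ℂ) :
    coneRingMap h (AddMonoidAlgebra.single m c) =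
      AddMonoidAlgebra.single (AddSubmonoid.inclusion (dualMonoid_anti h) m) c := by
  simp [coneRingMap]

lemma coneRingMap_injective {τ σ : PointedCone ℝ (ℝ ⊗[ℤ] N)} (h : τ ≤ σ) :
    Function.Injective (coneRingMap h) :=
  AddMonoidAlgebra.mapDomain_injective (AddSubmonoid.inclusion_injective (dualMonoid_anti h))

/-- The inclusion of coordinate rings attached to a face is a localization. -/
lemma isLocalization_coneRingMap {τ σ : PointedCone ℝ (ℝ ⊗[ℤ] N)} (h : τ ≤ σ)
    (hσ : IsSmoothCone σ) (m : dualMonoid σ)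
    (hτ : ∀ v, v ∈ τ ↔ v ∈ σ ∧ pairing m.1 v = 0) :
    let _ := (coneRingMap h).toAlgebra
    IsLocalization.Away (character m) (coneRing τ) := by
  let _ := (coneRingMap h).toAlgebra
  have hneg : -m.1 ∈ dualMonoid τ := by
    intro v hv
    have : pairing (-m.1) v = - pairing m.1 v := by
      simp [pairing]
    rw [this, ((hτ v).1 hv).2, neg_zero]
  have hpow : ∀ k : ℕ, character m ^ k = AddMonoidAlgebra.single (k • m) 1 := by
    intro k
    simp [character, AddMonoidAlgebra.single_pow]
  have halg : ∀ x, algebraMap (coneRing σ) (coneRing τ) x = coneRingMap h x := fun _ => rfl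
  refine ⟨?_, ?_, ?_⟩
  · rintro ⟨_, k, rfl⟩
    simp only [map_pow]
    refine IsUnit.pow k (IsUnit.of_mul_eq_one (character ⟨_, hneg⟩) ?_)
    rw [halg, character, coneRingMap_single, character, AddMonoidAlgebra.single_mul_single, mul_one,
      AddMonoidAlgebra.one_def]
    congr 1
    ext1
    simp
  · intro z
    suffices ∃ (k : ℕ) (x : coneRing σ), z * coneRingMap h (character m ^ k) = coneRingMap h x by
      obtain ⟨k, x, hx⟩ := this
      exact ⟨(x, ⟨_, k, rfl⟩), hx⟩
    induction z using AddMonoidAlgebra.induction_linear with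
    | zero => exact ⟨0, 0, by simp⟩
    | add f g hf hg =>
      obtain ⟨k, x, hx⟩ := hf
      obtain ⟨l, y, hy⟩ := hg
      refine ⟨k + l, x * character m ^ l + y * character m ^ k, ?_⟩
      rw [pow_add, map_mul, map_add, map_mul, map_mul, ← hx, ← hy]
      ring
    | single u c =>
      obtain ⟨k, hk⟩ := exists_add_nsmul_mem hσ m.2 hτ u.2
      refine ⟨k, AddMonoidAlgebra.single ⟨_, hk⟩ c, ?_⟩
      rw [hpow, coneRingMap_single, coneRingMap_single, AddMonoidAlgebra.single_mul_single, mul_one]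
      rfl
  · intro x y hxy
    exact ⟨1, by rw [coneRingMap_injective h hxy]⟩

end Rings

section Fans

variable (N : Type) [AddCommGroup N]

/-- A finite smooth fan in `N_ℝ`, not necessarily complete. -/
structure SmoothFan where
  /-- The cones of the fan. -/
  cones : Set (PointedCone ℝ (ℝ ⊗[ℤ] N))
  finite : cones.Finite
  nonempty : cones.Nonempty
  smooth : ∀ σ ∈ cones, IsSmoothCone σ
  face_mem : ∀ σ ∈ cones, ∀ τ : PointedCone ℝ (ℝ ⊗[ℤ] N), τ.IsFaceOf σ → τ ∈ cones
  inf_isFaceOf : ∀ σ ∈ cones, ∀ τ ∈ cones, (σ ⊓ τ).IsFaceOf σ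

variable {N}

lemma IsSmoothCone.bot_isFaceOf {σ : PointedCone ℝ (ℝ ⊗[ℤ] N)} (hσ : IsSmoothCone σ) :
    (⊥ : PointedCone ℝ (ℝ ⊗[ℤ] N)).IsFaceOf σ := by
  classical
  obtain ⟨b, s, rfl⟩ := hσ
  let B := Algebra.TensorProduct.basis ℝ b
  have hB : ∀ i v, B.coord i v = pairing (b.coord i) v := by
    intro i v
    induction v using TensorProduct.induction_on with
    | zero => simp
    | tmul r n => simp [B, mul_comm]
    | add x y hx hy => rw [map_add, map_add, hx, hy]
  have hpos : ∀ i, b.coord i ∈ dualMonoid (latticeCone (b '' s)) := by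
    intro i
    refine nonneg_of_latticeCone ?_
    rintro _ ⟨j, -, rfl⟩
    simp only [Module.Basis.coord_apply, Module.Basis.repr_self, Finsupp.single_apply]
    split_ifs <;> simp
  refine ⟨bot_le, fun {x y a} hx hy ha h => ?_⟩
  rw [Submodule.mem_bot] at h ⊢
  refine B.ext_elem fun i => ?_
  have h1 := hpos i x hx
  have h2 := hpos i y hy
  have h3 : a * pairing (b.coord i) x + pairing (b.coord i) y = 0 := by
    rw [← smul_eq_mul, ← map_smul, ← map_add, h, map_zero]
  have h4 : pairing (b.coord i) x = 0 := by
    have := mul_nonneg ha.le h1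
    have h5 : a * pairing (b.coord i) x = 0 := by linarith
    exact (mul_eq_zero.1 h5).resolve_left ha.ne'
  have := hB i x
  rw [h4] at this
  simpa using this

namespace SmoothFan

variable (Δ : SmoothFan N)

lemma bot_mem : ⊥ ∈ Δ.cones := by
  obtain ⟨σ, hσ⟩ := Δ.nonempty
  exact Δ.face_mem σ hσ _ (Δ.smooth σ hσ).bot_isFaceOf

/-- The cones of the fan, ordered by inclusion (equivalently, by the face relation). -/
abbrev Cone : Type := {σ : PointedCone ℝ (ℝ ⊗[ℤ] N) // σ ∈ Δ.cones}

/-- The zero cone. -/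
def zeroCone : Δ.Cone := ⟨⊥, Δ.bot_mem⟩

variable {Δ} in
lemma isFaceOf_of_le {τ σ : Δ.Cone} (h : τ ≤ σ) : τ.1.IsFaceOf σ.1 := by
  have := Δ.inf_isFaceOf σ.1 σ.2 τ.1 τ.2
  rwa [inf_eq_right.2 h] at this

/-- The set `Δ(1)` of one-dimensional cones. -/
abbrev Ray : Type :=
  {ρ : Δ.Cone // Module.finrank ℝ (Submodule.span ℝ (ρ.1 : Set (ℝ ⊗[ℤ] N))) = 1}

instance : Finite Δ.Cone := Δ.finite

variable {Δ} in
/-- The primitive generator `n(ρ)` of a one-dimensional cone. -/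
def Ray.generator (ρ : Δ.Ray) : N :=
  (exists_primitive (Δ.smooth _ ρ.1.2) ρ.2).choose

variable {Δ} in
lemma Ray.generator_spec (ρ : Δ.Ray) :
    IsPrimitive ρ.generator ∧ ρ.1.1 = latticeCone {ρ.generator} :=
  (exists_primitive (Δ.smooth _ ρ.1.2) ρ.2).choose_spec

/-- The diagram of affine toric varieties `U_σ = Spec ℂ[M ∩ σ^∨]`. -/
def affineDiagram : Δ.Cone ⥤ Scheme.{0} where
  obj σ := Spec (.of (coneRing σ.1))
  map {τ σ} h := Spec.map (CommRingCat.ofHom (coneRingMap (leOfHom h)))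
  map_id σ := by
    rw [← Spec.map_id]
    exact congrArg (fun f => Spec.map (CommRingCat.ofHom f))
      (AddMonoidAlgebra.mapDomainRingHom_id (R := ℂ))
  map_comp {σ₁ σ₂ σ₃} f g := by
    rw [← Spec.map_comp]
    exact congrArg (fun f => Spec.map (CommRingCat.ofHom f))
      (AddMonoidAlgebra.mapDomainRingHom_comp (R := ℂ)
        (AddSubmonoid.inclusion (dualMonoid_anti (leOfHom f)))
        (AddSubmonoid.inclusion (dualMonoid_anti (leOfHom g))))

variable {Δ} in
lemma exists_range_eq {τ σ : Δ.Cone} (f : τ ⟶ σ) :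
    ∃ m : dualMonoid σ.1, (∀ v, v ∈ τ.1 ↔ v ∈ σ.1 ∧ pairing m.1 v = 0) ∧
      IsOpenImmersion (Δ.affineDiagram.map f) ∧
      Set.range (Δ.affineDiagram.map f) =
        (PrimeSpectrum.basicOpen (character m) : Set (PrimeSpectrum (coneRing σ.1))) := by
  obtain ⟨m, hm, h⟩ := exists_supporting (Δ.smooth _ σ.2) (isFaceOf_of_le (leOfHom f))
  refine ⟨⟨m, hm⟩, h, ?_⟩
  have hloc := isLocalization_coneRingMap (leOfHom f) (Δ.smooth _ σ.2) ⟨m, hm⟩ h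
  let _ := (coneRingMap (leOfHom f)).toAlgebra
  exact ⟨IsOpenImmersion.of_isLocalization (character ⟨m, hm⟩),
    PrimeSpectrum.localization_away_comap_range _ (character ⟨m, hm⟩)⟩

instance {τ σ : Δ.Cone} (f : τ ⟶ σ) : IsOpenImmersion (Δ.affineDiagram.map f) :=
  (exists_range_eq f).choose_spec.2.1

instance : (Δ.affineDiagram ⋙ Scheme.forget).IsLocallyDirected where
  cond {i j k} fi fj xi xj hx := by
    change Δ.affineDiagram.map fi xi = Δ.affineDiagram.map fj xj at hx
    have hij : i.1 ⊓ j.1 ∈ Δ.cones :=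
      Δ.face_mem _ i.2 _ (Δ.inf_isFaceOf _ i.2 _ j.2)
    let l : Δ.Cone := ⟨i.1 ⊓ j.1, hij⟩
    let fli : l ⟶ i := homOfLE (show i.1 ⊓ j.1 ≤ i.1 from inf_le_left)
    let flj : l ⟶ j := homOfLE (show i.1 ⊓ j.1 ≤ j.1 from inf_le_right)
    obtain ⟨mi, hmi, -, ri⟩ := exists_range_eq fi
    obtain ⟨mj, hmj, -, rj⟩ := exists_range_eq fj
    have hm : ∀ v, v ∈ l.1 ↔ v ∈ k.1 ∧ pairing (mi + mj).1 v = 0 := by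
      intro v
      have e : pairing (mi + mj).1 v = pairing mi.1 v + pairing mj.1 v := by
        rw [AddSubmonoid.coe_add, pairing_add]; rfl
      change v ∈ i.1 ∧ v ∈ j.1 ↔ _
      rw [hmi, hmj, e]
      constructor
      · rintro ⟨⟨h1, h2⟩, -, h3⟩
        exact ⟨h1, by rw [h2, h3, add_zero]⟩
      · rintro ⟨h1, h2⟩
        have := mi.2 v h1
        have := mj.2 v h1
        exact ⟨⟨h1, by linarith⟩, h1, by linarith⟩
    have hloc := isLocalization_coneRingMap (leOfHom (fli ≫ fi)) (Δ.smooth _ k.2) (mi + mj) hm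
    let _ := (coneRingMap (leOfHom (fli ≫ fi))).toAlgebra
    have rl : Set.range (Δ.affineDiagram.map (fli ≫ fi)) =
        (PrimeSpectrum.basicOpen (character (mi + mj)) : Set (PrimeSpectrum (coneRing k.1))) :=
      PrimeSpectrum.localization_away_comap_range _ (character (mi + mj))
    have hxi : Δ.affineDiagram.map fi xi ∈ Set.range (Δ.affineDiagram.map fi) := ⟨xi, rfl⟩
    have hxj : Δ.affineDiagram.map fi xi ∈ Set.range (Δ.affineDiagram.map fj) := ⟨xj, hx.symm⟩
    rw [ri] at hxi
    rw [rj] at hxj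
    have hmul : character (mi + mj) = character mi * character mj := by
      simp [character, AddMonoidAlgebra.single_mul_single]
    have hxl : Δ.affineDiagram.map fi xi ∈ Set.range (Δ.affineDiagram.map (fli ≫ fi)) := by
      rw [rl, hmul, PrimeSpectrum.basicOpen_mul]
      exact ⟨hxi, hxj⟩
    obtain ⟨x, hxl⟩ := hxl
    refine ⟨l, fli, flj, x, ?_, ?_⟩
    · apply (Δ.affineDiagram.map fi).isOpenEmbedding.injective
      rw [Functor.map_comp, Scheme.Hom.comp_apply] at hxl
      exact hxl
    · apply (Δ.affineDiagram.map fj).isOpenEmbedding.injective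
      rw [show fli ≫ fi = flj ≫ fj from Subsingleton.elim _ _, Functor.map_comp,
        Scheme.Hom.comp_apply, hx] at hxl
      exact hxl

/-- The toric variety `X` of the fan: the gluing of the affine toric varieties `U_σ` along
the open immersions `U_τ → U_σ` for `τ` a face of `σ`. -/
def toricVariety : Scheme.{0} := colimit Δ.affineDiagram

/-- The open chart `U_σ → X`. -/
def chart (σ : Δ.Cone) : Spec (.of (coneRing σ.1)) ⟶ Δ.toricVariety :=
  colimit.ι Δ.affineDiagram σ

instance (σ : Δ.Cone) : IsOpenImmersion (Δ.chart σ) :=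
  inferInstanceAs (IsOpenImmersion (colimit.ι Δ.affineDiagram σ))

/-- The structure morphism `X → Spec ℂ`. -/
def toSpec : Δ.toricVariety ⟶ Spec (.of ℂ) :=
  colimit.desc Δ.affineDiagram
    { pt := Spec (.of ℂ)
      ι :=
        { app := fun σ => Spec.map (CommRingCat.ofHom (algebraMap ℂ (coneRing σ.1)))
          naturality := by
            intro τ σ f
            refine (Spec.map_comp _ _).symm.trans ?_
            refine Eq.trans (congrArg Spec.map ?_) (Category.comp_id _).symm
            rw [← CommRingCat.ofHom_comp]
            congr 1
            ext1 c
            simp [coneRingMap_single] } }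

/-- The torus `T = U_{0} = Spec ℂ[M]`, as an open subset of `X`. -/
def torus : Δ.toricVariety.Opens := Δ.chart Δ.zeroCone ''ᵁ ⊤

/-- The character `e(m)` of `T`, as a regular function on `T ⊆ X`. -/
def torusCharacter (m : Module.Dual ℤ N) : Γ(Δ.toricVariety, Δ.torus) :=
  ((Δ.chart Δ.zeroCone).appIso ⊤).inv
    ((Scheme.ΓSpecIso (.of (coneRing Δ.zeroCone.1))).inv
      (character ⟨m, mem_dualMonoid_bot m⟩))

/-- The homomorphism `ℂ[M] → ℂ` with `e(m) ↦ 1` for all `m`. -/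
def augmentation : coneRing Δ.zeroCone.1 →+* ℂ :=
  (AddMonoidAlgebra.lift ℂ ℂ (dualMonoid Δ.zeroCone.1) 1).toRingHom

/-- The identity element `1 ∈ T`, as a point of `X`. -/
def identityPoint : Δ.toricVariety :=
  (Spec.map (CommRingCat.ofHom Δ.augmentation) ≫ Δ.chart Δ.zeroCone)
    (IsLocalRing.closedPoint ℂ)

variable {Δ} in
/-- The orbit `orb σ`: the points of `U_σ` at which `e(m)` vanishes for all `m ∈ M ∩ σ^∨` outside
`σ^⊥`. -/
def orbit (σ : Δ.Cone) : Set Δ.toricVariety :=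
  Δ.chart σ '' {p : PrimeSpectrum (coneRing σ.1) |
    ∀ m : dualMonoid σ.1, (∃ v ∈ σ.1, pairing m.1 v ≠ 0) → character m ∈ p.asIdeal}

variable {Δ} in
/-- The prime divisor `V(ρ)`, the closure of `orb ρ`. -/
def Ray.divisor (ρ : Δ.Ray) : TopologicalSpace.Closeds Δ.toricVariety :=
  TopologicalSpace.Closeds.closure (orbit ρ.1)

instance : Fintype Δ.Ray := Fintype.ofFinite _

end SmoothFan
end Fans

section Divisors

/-- The stalk at `x` of the ideal sheaf of functions vanishing on the closed subset `Z`. -/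
def idealStalk {X : Scheme.{0}} (Z : TopologicalSpace.Closeds X) (x : X) :
    Ideal (X.presheaf.stalk x) :=
  ⨆ (U : X.affineOpens) (h : x ∈ U.1),
    Ideal.map (X.presheaf.germ U.1 x h).hom
      ((Scheme.IdealSheafData.vanishingIdeal Z).ideal U)

/-- The multiplicity at `y` of the scheme-theoretic preimage `f⁻¹(Z)`, where `Z` carries its reduced
structure: the length of the local ring `𝒪_{Y,y} / I_{Z,f(y)} 𝒪_{Y,y}` of `f⁻¹(Z)` at `y`. For `y` of
codimension one this is the coefficient of the prime divisor `closure {y}` in the pull-back of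
the divisor `Z`. -/
def pullbackMultiplicity {X Y : Scheme.{0}} (f : Y ⟶ X) (Z : TopologicalSpace.Closeds X) (y : Y) :
    ℕ∞ :=
  Module.length (Y.presheaf.stalk y)
    (Y.presheaf.stalk y ⧸ Ideal.map (f.stalkMap y).hom (idealStalk Z (f y)))

/-- An effective Weil divisor: a locally finite formal sum of prime divisors (represented by
their generic points, the points of codimension one) with natural numbers as coefficients. -/
@[ext]
structure EffectiveWeilDivisor (Y : Scheme.{0}) where
  /-- The coefficients. -/
  coeff : AlgebraicCycle Y ℕ
  codim_one : ∀ y, coeff y ≠ 0 → Order.coheight y = 1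

/-- The support of a divisor: the union of its prime components. -/
def EffectiveWeilDivisor.support {Y : Scheme.{0}} (D : EffectiveWeilDivisor Y) : Set Y :=
  closure (Function.support D.coeff)

/-- The open set `Y ∖ ⋃ D(ρ)`. -/
def complement {Y : Scheme.{0}} {ι : Type} [Finite ι] (D : ι → EffectiveWeilDivisor Y) : Y.Opens :=
  ⟨(⋃ i, (D i).support)ᶜ, (isClosed_iUnion_of_finite fun _ => isClosed_closure).isOpen_compl⟩

lemma EffectiveWeilDivisor.support_eq {Y : Scheme.{0}} (D : EffectiveWeilDivisor Y) :
    D.support = {y | ∃ z, D.coeff z ≠ 0 ∧ z ⤳ y} := by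
  ext y
  constructor
  · intro hy
    obtain ⟨t, ht, hfin⟩ := D.coeff.supportLocallyFiniteWithinDomain' y trivial
    have h1 : y ∈ closure (t ∩ Function.support D.coeff) := by
      rw [EffectiveWeilDivisor.support, mem_closure_iff_nhds] at hy
      rw [mem_closure_iff_nhds]
      intro u hu
      obtain ⟨w, hw, hw'⟩ := hy (u ∩ t) (Filter.inter_mem hu ht)
      exact ⟨w, hw.1, hw.2, hw'⟩
    change (t ∩ Function.support D.coeff).Finite at hfin
    rw [← Set.biUnion_of_singleton (t ∩ Function.support D.coeff), hfin.closure_biUnion] at h1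
    obtain ⟨z, hz, hzy⟩ := Set.mem_iUnion₂.1 h1
    exact ⟨z, hz.2, specializes_iff_mem_closure.2 hzy⟩
  · rintro ⟨z, hz, hzy⟩
    exact closure_mono (Set.singleton_subset_iff.2 hz) (specializes_iff_mem_closure.1 hzy)

lemma genericPoint_mem_complement {Y : Scheme.{0}} [IrreducibleSpace Y] {ι : Type} [Finite ι]
    (D : ι → EffectiveWeilDivisor Y) : genericPoint Y ∈ complement D := by
  rintro ⟨_, ⟨i, rfl⟩, h⟩
  simp only [EffectiveWeilDivisor.support_eq] at h
  obtain ⟨z, hz, hzy⟩ := h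
  have h1 := (D i).codim_one z hz
  have h2 : genericPoint Y ⤳ z := genericPoint_specializes z
  have h3 : z = genericPoint Y := (hzy.antisymm h2).eq
  rw [h3] at h1
  have h4 : IsMax (genericPoint Y) := fun w _ => genericPoint_specializes w
  rw [Order.coheight_eq_zero.2 h4] at h1
  exact zero_ne_one h1

instance {Y : Scheme.{0}} [IrreducibleSpace Y] {ι : Type} [Finite ι]
    (D : ι → EffectiveWeilDivisor Y) : Nonempty (complement D) :=
  ⟨⟨_, genericPoint_mem_complement D⟩⟩

end Divisors

/-- A normal algebraic variety over `ℂ`: an integral separated scheme of finite type over `ℂ` all of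
whose local rings are integrally closed. -/
structure NormalVariety where
  /-- The underlying scheme. -/
  scheme : Scheme.{0}
  /-- The structure morphism. -/
  toSpec : scheme ⟶ Spec (.of ℂ)
  [isIntegral : IsIntegral scheme]
  [isSeparated : IsSeparated toSpec]
  [locallyOfFiniteType : LocallyOfFiniteType toSpec]
  [quasiCompact : QuasiCompact toSpec]
  normal : ∀ y : scheme, IsIntegrallyClosed (scheme.presheaf.stalk y)

attribute [instance] NormalVariety.isIntegral NormalVariety.isSeparated
  NormalVariety.locallyOfFiniteType NormalVariety.quasiCompact

instance (Y : NormalVariety) : IsLocallyNoetherian Y.scheme :=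
  LocallyOfFiniteType.isLocallyNoetherian Y.toSpec

section Data

variable {N : Type} [AddCommGroup N]

/-- The pairs `({D(ρ)}, ε)`. -/
structure DivisorData (Δ : SmoothFan N) (Y : NormalVariety) where
  /-- The effective Weil divisors `D(ρ)`. -/
  D : Δ.Ray → EffectiveWeilDivisor Y.scheme
  /-- `D(ρ₁) ∩ ⋯ ∩ D(ρₛ) = ∅` whenever `ρ₁ + ⋯ + ρₛ` is not a cone of the fan. -/
  inter_eq_empty : ∀ s : Finset Δ.Ray, (⨆ ρ ∈ s, ρ.1.1) ∉ Δ.cones →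
    ⋂ ρ ∈ s, (D ρ).support = ∅
  /-- The homomorphism from `M` to the invertible regular functions on `Y ∖ ⋃ D(ρ)`. -/
  ε : Multiplicative (Module.Dual ℤ N) →* Γ(Y.scheme, complement D)ˣ
  /-- `div ε(m) = ∑ ⟨m, n(ρ)⟩ D(ρ)`. -/
  div_eq : ∀ (m : Module.Dual ℤ N) (y : Y.scheme), Order.coheight y = 1 →
    Scheme.ord (Y.scheme.germToFunctionField (complement D)
      (ε (Multiplicative.ofAdd m) : Γ(Y.scheme, complement D))) y =
      ∑ ρ, m ρ.generator * ((D ρ).coeff y : ℤ)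

/-- The pair `P` is the one attached to the morphism `f`: `D(ρ)` is the pull-back `f⁻¹(V(ρ))` for
every `ρ`, the open set `Y ∖ ⋃ D(ρ)` is `f⁻¹(T)`, and `ε(m)` is the pull-back of `e(m)`. -/
def IsAttached {Δ : SmoothFan N} {Y : NormalVariety} (f : Y.scheme ⟶ Δ.toricVariety)
    (P : DivisorData Δ Y) : Prop :=
  (∀ (ρ : Δ.Ray) (y : Y.scheme), Order.coheight y = 1 →
    pullbackMultiplicity f ρ.divisor y = ((P.D ρ).coeff y : ℕ∞)) ∧
  ∃ h : complement P.D = f ⁻¹ᵁ Δ.torus, ∀ m : Module.Dual ℤ N,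
    (P.ε (Multiplicative.ofAdd m) : Γ(Y.scheme, complement P.D)) =
      Y.scheme.presheaf.map (eqToHom h).op (f.app Δ.torus (Δ.torusCharacter m))

/-- `ε(m)` is defined at `y₀` and has the value `1` there, for all `m`. -/
def DivisorData.IsOneAt {Δ : SmoothFan N} {Y : NormalVariety} (P : DivisorData Δ Y)
    (y₀ : Y.scheme) : Prop :=
  ∃ h : y₀ ∈ complement P.D, ∀ m : Module.Dual ℤ N,
    Y.scheme.evaluation (complement P.D) y₀ h
      (P.ε (Multiplicative.ofAdd m) : Γ(Y.scheme, complement P.D)) = 1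

end Data

end SmoothToric

end

/-!
A morphism `f : Y → X` with `f(y₀) = 1` maps the generic point `η` of `Y` into `T`, so it is determined
by the pull-back `ℂ[M] → K(Y)` of functions to the function field, together with the open sets
`f⁻¹(U_σ)`. Both are encoded in the pair `(D, ε)`.

On the chart `U_σ` with `ρ ≤ σ` the divisor `V(ρ)` has the local equation `e(m)`, where `m` is the
functional dual to `n(ρ)` with respect to the basis of `N` spanning `σ` (`rayIdeal_eq_span`,
`idealStalk_divisor`), and `V(ρ)` does not meet `U_σ` if `ρ` is not a ray of `σ` (`Ray.notMem_divisor`).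
Hence the multiplicity of `f⁻¹(V(ρ))` along a prime divisor is the order of `f^* e(m)`, and writing an
arbitrary functional in terms of the dual ones gives `div(f^* e(m)) = ∑ ⟨m, n(ρ)⟩ D(ρ)`
(`IsPullback.ord_eq`). A nonzero germ is invertible as soon as it is invertible in codimension one, so
`f⁻¹(U_σ)` is the complement of the `D(ρ)` with `ρ` not in `σ` (`IsPullback.mem_chartOpens_iff`). This
yields the condition on intersections, the equality `f⁻¹(T) = Y ∖ ⋃ D(ρ)`, and the attached pair
(`exists_isAttached`). It also shows that a pair is attached to at most one morphism
(`IsAttached.hom_unique`).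

Conversely, a pair gives a homomorphism `ℂ[M] → K(Y)`. Let `Y_σ` be the complement of the `D(ρ)` with `ρ`
not in `σ`. The condition on intersections says that the `Y_σ` cover `Y`. For `m ∈ M ∩ σ^∨` the
function `ε(m)` has nonnegative order along every prime divisor meeting `Y_σ`, so it is regular on
`Y_σ` by normality (`DivisorData.functionHom_mem_range`, resting on `mem_range_of_height_one`: a normal
Noetherian domain is the intersection of its localizations at height one primes). The resulting
homomorphisms `ℂ[M ∩ σ^∨] → Γ(Y_σ, 𝒪)` define morphisms `Y_σ → U_σ`, which glue
(`exists_hom_of_functions`), and the pair attached to the glued morphism is the given one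
(`DivisorData.exists_hom`).

Finally, a point of `T` is the identity element exactly when all characters have the value `1` at it
(`eq_identityPoint_iff`), so the base point conditions on the two sides agree.
-/

noncomputable section

namespace SmoothToric

/-! ### Rays and cones of a smooth fan -/

section ConeCoordinates

variable {N : Type} [AddCommGroup N] {ι : Type*} (b : Module.Basis ι ℤ N)

lemma pairing_smul (m : Module.Dual ℤ N) (a : ℝ) (v : ℝ ⊗[ℤ] N) :
    pairing m (a • v) = a * pairing m v := by
  rw [← smul_eq_mul, ← map_smul]

lemma pairing_eq_sum [Fintype ι] (m : Module.Dual ℤ N) (v : ℝ ⊗[ℤ] N) :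
    pairing m v = ∑ i, m (b i) * pairing (b.coord i) v := by
  induction v using TensorProduct.induction_on with
  | zero => simp
  | tmul r n =>
    have h : m n = ∑ i, b.repr n i * m (b i) := by
      conv_lhs => rw [← b.sum_repr n, map_sum]
      exact Finset.sum_congr rfl fun i _ => by simp
    simp only [pairing_tmul, h, Module.Basis.coord_apply]
    push_cast
    rw [Finset.sum_mul]
    exact Finset.sum_congr rfl fun i _ => by ring
  | add x y hx hy => simp only [map_add, hx, hy, mul_add, Finset.sum_add_distrib]

lemma eq_of_pairing_coord_eq {v w : ℝ ⊗[ℤ] N}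
    (h : ∀ i, pairing (b.coord i) v = pairing (b.coord i) w) : v = w := by
  classical
  let B := Algebra.TensorProduct.basis ℝ b
  have hB : ∀ i v, B.coord i v = pairing (b.coord i) v := by
    intro i v
    induction v using TensorProduct.induction_on with
    | zero => simp
    | tmul r n => simp [B, mul_comm]
    | add x y hx hy => rw [map_add, map_add, hx, hy]
  refine B.ext_elem fun i => ?_
  have := h i
  rw [← hB, ← hB] at this
  simpa using this

/-- The cone spanned by a part of a lattice basis, in coordinates. -/
lemma mem_latticeCone_basis [Fintype ι] {s : Set ι} {v : ℝ ⊗[ℤ] N} :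
    v ∈ latticeCone (b '' s) ↔
      (∀ i, 0 ≤ pairing (b.coord i) v) ∧ ∀ i ∉ s, pairing (b.coord i) v = 0 := by
  classical
  constructor
  · intro hv
    induction hv using Submodule.span_induction with
    | mem x hx =>
      obtain ⟨_, ⟨j, hj, rfl⟩, rfl⟩ := hx
      constructor
      · intro i
        simp only [pairing_tmul, Module.Basis.coord_apply, Module.Basis.repr_self,
          Finsupp.single_apply]
        split_ifs <;> simp
      · intro i hi
        have : j ≠ i := by rintro rfl; exact hi hj
        simp [this]
    | zero => simp
    | add x y _ _ hx hy =>
      exact ⟨fun i => by rw [map_add]; exact add_nonneg (hx.1 i) (hy.1 i),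
        fun i hi => by rw [map_add, hx.2 i hi, hy.2 i hi, add_zero]⟩
    | smul a x _ hx =>
      have e : ∀ m : Module.Dual ℤ N, pairing m (a • x) = a.1 * pairing m x :=
        fun m => pairing_smul m a.1 x
      exact ⟨fun i => by rw [e]; exact mul_nonneg a.2 (hx.1 i),
        fun i hi => by rw [e, hx.2 i hi, mul_zero]⟩
  · rintro ⟨h0, hs⟩
    have hv : v = ∑ i, pairing (b.coord i) v • ((1 : ℝ) ⊗ₜ[ℤ] b i) := by
      refine eq_of_pairing_coord_eq b fun i => ?_
      simp [Finsupp.single_apply]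
    rw [hv]
    refine sum_mem fun i _ => ?_
    by_cases hi : i ∈ s
    · exact PointedCone.smul_mem _ (h0 i) (tmul_mem_latticeCone ⟨i, hi, rfl⟩)
    · rw [hs i hi, zero_smul]; exact zero_mem _

lemma isFaceOf_latticeCone [Fintype ι] {t s : Set ι} (h : t ⊆ s) :
    (latticeCone (b '' t)).IsFaceOf (latticeCone (b '' s)) := by
  refine ⟨fun v hv => ?_, fun {x y a} hx hy ha hxy => ?_⟩
  · rw [mem_latticeCone_basis] at hv ⊢
    exact ⟨hv.1, fun i hi => hv.2 i fun hi' => hi (h hi')⟩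
  · rw [mem_latticeCone_basis] at hx hy hxy ⊢
    refine ⟨hx.1, fun i hi => ?_⟩
    have h1 := hxy.2 i hi
    rw [map_add, pairing_smul] at h1
    have h2 := mul_nonneg ha.le (hx.1 i)
    have h3 := hy.1 i
    exact (mul_eq_zero.1 (by linarith : a * pairing (b.coord i) x = 0)).resolve_left ha.ne'

lemma mem_dualMonoid_basis {s : Set ι} {m : Module.Dual ℤ N} :
    m ∈ dualMonoid (latticeCone (b '' s)) ↔ ∀ i ∈ s, 0 ≤ m (b i) := by
  constructor
  · intro h i hi
    have := h _ (tmul_mem_latticeCone (S := b '' s) ⟨i, hi, rfl⟩)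
    simpa using this
  · intro h
    refine nonneg_of_latticeCone ?_
    rintro _ ⟨i, hi, rfl⟩
    exact h i hi

end ConeCoordinates

namespace SmoothFan

variable {N : Type} [AddCommGroup N] {Δ : SmoothFan N}

lemma Ray.generator_mem (ρ : Δ.Ray) : (1 : ℝ) ⊗ₜ[ℤ] ρ.generator ∈ ρ.1.1 := by
  exact ρ.generator_spec.2.ge (tmul_mem_latticeCone rfl)

lemma Ray.ext_generator {ρ ρ' : Δ.Ray} (h : ρ.generator = ρ'.generator) : ρ = ρ' := by
  refine Subtype.ext (Subtype.ext ?_)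
  rw [ρ.generator_spec.2, ρ'.generator_spec.2, h]

lemma Ray.le_iff {ρ : Δ.Ray} {σ : PointedCone ℝ (ℝ ⊗[ℤ] N)} :
    ρ.1.1 ≤ σ ↔ (1 : ℝ) ⊗ₜ[ℤ] ρ.generator ∈ σ := by
  constructor
  · exact fun h => h ρ.generator_mem
  · intro h
    rw [ρ.generator_spec.2, latticeCone, Set.image_singleton]
    exact Submodule.span_le.2 (Set.singleton_subset_iff.2 h)

lemma Ray.not_le_zeroCone (ρ : Δ.Ray) : ¬ ρ.1 ≤ Δ.zeroCone := by
  intro h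
  have h1 : ρ.1.1 = ⊥ := le_bot_iff.1 h
  have h2 := ρ.2
  rw [h1, Submodule.bot_coe, Submodule.span_zero_singleton, finrank_bot] at h2
  exact zero_ne_one h2

/-- A ray of a smooth cone is spanned by a vector of the basis generating the cone. -/
lemma Ray.exists_basis_eq {σ : Δ.Cone} {ι : Type} [Fintype ι] (b : Module.Basis ι ℤ N) {s : Set ι}
    (hσ : σ.1 = latticeCone (b '' s)) (ρ : Δ.Ray) (h : ρ.1 ≤ σ) :
    ∃ i ∈ s, ρ.generator = b i := by
  classical
  obtain ⟨m, hm, hmρ⟩ := exists_supporting (Δ.smooth _ σ.2) (isFaceOf_of_le h)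
  obtain ⟨hprim, hρ⟩ := ρ.generator_spec
  set n := ρ.generator
  have hn := (hmρ _).1 ρ.generator_mem
  have hn1 := hn.1
  rw [hσ, mem_latticeCone_basis] at hn1
  simp only [pairing_tmul, mul_one, Int.cast_nonneg_iff, Int.cast_eq_zero] at hn1
  rw [hσ, mem_dualMonoid_basis] at hm
  -- Some basis vector `b i` occurs in the generator `n`; as the ray is a face, it contains `b i`, so
  -- `b i` and `n` are proportional, and they agree because both are primitive.
  obtain ⟨i, hi⟩ : ∃ i, b.coord i n ≠ 0 := by
    by_contra! hc
    exact hprim.1 (b.ext_elem fun i => by simpa using hc i)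
  have his : i ∈ s := by
    by_contra his
    exact hi (hn1.2 i his)
  have hmi : m (b i) = 0 := by
    have h0 := hn.2
    rw [pairing_eq_sum b] at h0
    have hnn : ∀ j ∈ Finset.univ, (0 : ℝ) ≤
        m (b j) * pairing (b.coord j) ((1 : ℝ) ⊗ₜ[ℤ] n) := by
      intro j _
      simp only [pairing_tmul, mul_one]
      by_cases hj : j ∈ s
      · exact mul_nonneg (by exact_mod_cast hm j hj) (by exact_mod_cast hn1.1 j)
      · rw [hn1.2 j hj]; simp
    have := (Finset.sum_eq_zero_iff_of_nonneg hnn).1 h0 i (Finset.mem_univ _)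
    simp only [pairing_tmul, mul_one, mul_eq_zero, Int.cast_eq_zero] at this
    exact this.resolve_right hi
  have hbi : (1 : ℝ) ⊗ₜ[ℤ] b i ∈ ρ.1.1 := by
    rw [hmρ, hσ]
    exact ⟨tmul_mem_latticeCone ⟨i, his, rfl⟩, by simp [hmi]⟩
  rw [hρ, latticeCone, Set.image_singleton] at hbi
  obtain ⟨r, hr⟩ := Submodule.mem_span_singleton.1 hbi
  have hcoord : ∀ j, (r : ℝ) * b.coord j n = if i = j then 1 else 0 := by
    intro j
    have h1 : pairing (b.coord j) (r • ((1 : ℝ) ⊗ₜ[ℤ] n)) = r * pairing (b.coord j) (1 ⊗ₜ[ℤ] n) :=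
      pairing_smul _ r.1 _
    rw [hr] at h1
    simp only [pairing_tmul, mul_one, Module.Basis.coord_apply, Module.Basis.repr_self,
      Finsupp.single_apply] at h1 ⊢
    rw [← h1]
    split_ifs <;> simp
  have hr0 : (r : ℝ) ≠ 0 := by
    intro h0
    have := hcoord i
    simp [h0] at this
  have hni : n = b.coord i n • b i := by
    refine b.ext_elem fun j => ?_
    by_cases hij : i = j
    · subst hij; simp
    · have := hcoord j
      rw [if_neg hij, mul_eq_zero, Int.cast_eq_zero] at this
      simpa [Finsupp.single_apply, hij] using this.resolve_left hr0
  refine ⟨i, his, ?_⟩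
  have hu := hprim.2 _ _ hni
  have h1 : b.coord i n = 1 := by
    rcases Int.isUnit_iff.1 hu with h | h
    · exact h
    · exact absurd (hn1.1 i) (by rw [h]; decide)
  rw [h1, one_smul] at hni
  exact hni

/-- The basis vectors spanning a smooth cone are generators of rays of the fan. -/
lemma exists_ray_generator_eq {σ : Δ.Cone} {ι : Type} [Fintype ι] (b : Module.Basis ι ℤ N)
    {s : Set ι} (hσ : σ.1 = latticeCone (b '' s)) {i : ι} (hi : i ∈ s) :
    ∃ ρ : Δ.Ray, ρ.1 ≤ σ ∧ ρ.generator = b i := by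
  classical
  have hface := isFaceOf_latticeCone b (Set.singleton_subset_iff.2 hi)
  rw [← hσ] at hface
  have hmem := Δ.face_mem _ σ.2 _ hface
  have hne : (1 : ℝ) ⊗ₜ[ℤ] b i ≠ 0 := by
    intro h0
    have := congrArg (pairing (b.coord i)) h0
    simp at this
  have hdim : Module.finrank ℝ
      (Submodule.span ℝ (latticeCone (b '' {i}) : Set (ℝ ⊗[ℤ] N))) = 1 := by
    have : Submodule.span ℝ (latticeCone (b '' {i}) : Set (ℝ ⊗[ℤ] N))
        = Submodule.span ℝ {(1 : ℝ) ⊗ₜ[ℤ] b i} := by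
      apply le_antisymm
      · refine Submodule.span_le.2 fun v hv => ?_
        have := PointedCone.hull_le_span (R := ℝ) _ hv
        simpa using this
      · refine Submodule.span_mono (Set.singleton_subset_iff.2 ?_)
        exact tmul_mem_latticeCone ⟨i, rfl, rfl⟩
    rw [this, finrank_span_singleton hne]
  let ρ : Δ.Ray := ⟨⟨_, hmem⟩, hdim⟩
  refine ⟨ρ, hface.le, ?_⟩
  obtain ⟨j, hj, h⟩ := ρ.exists_basis_eq (σ := ⟨_, hmem⟩) b rfl le_rfl
  rw [h, Set.mem_singleton_iff.1 hj]

/-- Duality between a cone of a smooth fan and its dual monoid: the dual monoid consists of the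
functionals that are nonnegative on the ray generators of the cone. -/
lemma mem_dualMonoid_iff (σ : Δ.Cone) {m : Module.Dual ℤ N} :
    m ∈ dualMonoid σ.1 ↔ ∀ ρ : Δ.Ray, ρ.1 ≤ σ → 0 ≤ m ρ.generator := by
  obtain ⟨b, s, hσ⟩ := Δ.smooth _ σ.2
  constructor
  · intro h ρ hρ
    have := h _ (hρ ρ.generator_mem)
    simpa using this
  · intro h
    rw [hσ, mem_dualMonoid_basis]
    intro i hi
    obtain ⟨ρ, hρ, he⟩ := exists_ray_generator_eq b hσ hi
    rw [← he]
    exact h ρ hρ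

/-- The functionals dual to the ray generators of a smooth cone. -/
lemma exists_dual_ray {σ : Δ.Cone} {ρ : Δ.Ray} (h : ρ.1 ≤ σ) :
    ∃ m ∈ dualMonoid σ.1, m ρ.generator = 1 ∧
      ∀ ρ' : Δ.Ray, ρ'.1 ≤ σ → ρ' ≠ ρ → m ρ'.generator = 0 := by
  classical
  obtain ⟨b, s, hσ⟩ := Δ.smooth _ σ.2
  obtain ⟨i, hi, he⟩ := ρ.exists_basis_eq b hσ h
  refine ⟨b.coord i, ?_, by simp [he], fun ρ' hρ' hne => ?_⟩
  · rw [hσ, mem_dualMonoid_basis]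
    intro j _
    simp only [Module.Basis.coord_apply, Module.Basis.repr_self, Finsupp.single_apply]
    split_ifs <;> simp
  · obtain ⟨j, hj, he'⟩ := ρ'.exists_basis_eq b hσ hρ'
    have : j ≠ i := by
      rintro rfl
      exact hne (Ray.ext_generator (he'.trans he.symm))
    simp [he', this]

/-- The sum of some rays of a cone of a smooth fan is again a cone of the fan. -/
lemma iSup_rays_mem {σ : Δ.Cone} (t : Finset Δ.Ray) (h : ∀ ρ ∈ t, ρ.1 ≤ σ) :
    (⨆ ρ ∈ t, ρ.1.1) ∈ Δ.cones := by
  obtain ⟨b, s, hσ⟩ := Δ.smooth _ σ.2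
  have key : (⨆ ρ ∈ t, ρ.1.1) = latticeCone (b '' {i | i ∈ s ∧ ∃ ρ ∈ t, ρ.generator = b i}) := by
    apply le_antisymm
    · refine iSup₂_le fun ρ hρ => ?_
      obtain ⟨i, hi, he⟩ := ρ.exists_basis_eq b hσ (h ρ hρ)
      rw [Ray.le_iff, he]
      exact tmul_mem_latticeCone ⟨i, ⟨hi, ρ, hρ, he⟩, rfl⟩
    · refine Submodule.span_le.2 ?_
      rintro _ ⟨_, ⟨i, ⟨-, ρ, hρ, he⟩, rfl⟩, rfl⟩
      dsimp only
      rw [← he]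
      exact (le_iSup₂ (f := fun (ρ : Δ.Ray) (_ : ρ ∈ t) => ρ.1.1) ρ hρ) ρ.generator_mem
  rw [key]
  refine Δ.face_mem _ σ.2 _ ?_
  rw [hσ]
  exact isFaceOf_latticeCone b fun i hi => hi.1

end SmoothFan

/-! ### The ideal of a ray in the coordinate ring of a cone -/

section ConeRings

variable {N : Type} [AddCommGroup N]

instance : TwoUniqueSums (Module.Dual ℤ N) :=
  TwoUniqueSums.of_injective_addHom
    (⟨fun m n => m n, fun _ _ => rfl⟩ : AddHom (Module.Dual ℤ N) (N → ℤ))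
    DFunLike.coe_injective inferInstance

instance (σ : PointedCone ℝ (ℝ ⊗[ℤ] N)) : TwoUniqueSums (dualMonoid σ) :=
  TwoUniqueSums.of_injective_addHom (dualMonoid σ).subtype.toAddHom
    Subtype.val_injective inferInstance

instance (σ : PointedCone ℝ (ℝ ⊗[ℤ] N)) : IsDomain (coneRing σ) :=
  NoZeroDivisors.to_isDomain _

/-- The elements of the dual monoid of `σ` are nonnegative on the vector `n`. -/
def Supports (σ : PointedCone ℝ (ℝ ⊗[ℤ] N)) (n : N) : Prop := ∀ m ∈ dualMonoid σ, 0 ≤ m n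

open Classical in
/-- The endomorphism of `ℂ[M ∩ σ^∨]` that kills the characters which are positive on `n` and fixes
the other ones. Its kernel is the ideal of the orbit closure of the ray through `n`. -/
def killPositive {σ : PointedCone ℝ (ℝ ⊗[ℤ] N)} {n : N} (h : Supports σ n) :
    coneRing σ →ₐ[ℂ] coneRing σ :=
  AddMonoidAlgebra.lift ℂ (coneRing σ) (dualMonoid σ)
    { toFun := fun m => if m.toAdd.1 n = 0 then character m.toAdd else 0
      map_one' := by simp [character, AddMonoidAlgebra.one_def]
      map_mul' := fun m m' => by
        have h1 := h _ m.toAdd.2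
        have h2 := h _ m'.toAdd.2
        have e : (m * m').toAdd.1 n = m.toAdd.1 n + m'.toAdd.1 n := rfl
        by_cases h3 : m.toAdd.1 n = 0 <;> by_cases h4 : m'.toAdd.1 n = 0
        · rw [if_pos h3, if_pos h4, if_pos (by rw [e, h3, h4, add_zero])]
          simp [character, AddMonoidAlgebra.single_mul_single]
        all_goals
          rw [if_neg (by rw [e]; omega)]
          simp [h3, h4] }

open Classical in
lemma killPositive_single {σ : PointedCone ℝ (ℝ ⊗[ℤ] N)} {n : N} (h : Supports σ n)
    (m : dualMonoid σ) (c : ℂ) : killPositive h (AddMonoidAlgebra.single m c) =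
      if m.1 n = 0 then AddMonoidAlgebra.single m c else 0 := by
  rw [killPositive, AddMonoidAlgebra.lift_single]
  change c • (if m.1 n = 0 then character m else 0) = _
  split_ifs <;> simp [character]

lemma killPositive_coneRingMap {σ τ : PointedCone ℝ (ℝ ⊗[ℤ] N)} {n : N} (hτ : Supports τ n)
    (hσ : Supports σ n) (h : τ ≤ σ) (a : coneRing σ) :
    killPositive hτ (coneRingMap h a) = coneRingMap h (killPositive hσ a) := by
  classical
  induction a using AddMonoidAlgebra.induction_linear with
  | zero => simp
  | add f g hf hg => simp only [map_add, hf, hg]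
  | single m c =>
    rw [coneRingMap_single, killPositive_single, killPositive_single]
    change (if m.1 n = 0 then _ else _) = _
    split_ifs
    · rw [coneRingMap_single]
    · rw [map_zero]

/-- The prime ideal of `ℂ[M ∩ σ^∨]` spanned by the characters that are positive on `n`. -/
def rayIdeal {σ : PointedCone ℝ (ℝ ⊗[ℤ] N)} {n : N} (h : Supports σ n) : Ideal (coneRing σ) :=
  RingHom.ker (killPositive h)

instance {σ : PointedCone ℝ (ℝ ⊗[ℤ] N)} {n : N} (h : Supports σ n) : (rayIdeal h).IsPrime :=
  RingHom.ker_isPrime _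

lemma comap_rayIdeal {σ τ : PointedCone ℝ (ℝ ⊗[ℤ] N)} {n : N} (hτ : Supports τ n)
    (hσ : Supports σ n) (h : τ ≤ σ) : (rayIdeal hτ).comap (coneRingMap h) = rayIdeal hσ := by
  ext a
  rw [Ideal.mem_comap, rayIdeal, rayIdeal, RingHom.mem_ker, RingHom.mem_ker,
    killPositive_coneRingMap hτ hσ h, map_eq_zero_iff _ (coneRingMap_injective h)]

lemma character_mem_rayIdeal {σ : PointedCone ℝ (ℝ ⊗[ℤ] N)} {n : N} (h : Supports σ n)
    {m : dualMonoid σ} : character m ∈ rayIdeal h ↔ m.1 n ≠ 0 := by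
  classical
  rw [rayIdeal, RingHom.mem_ker, character, killPositive_single]
  split_ifs with h0 <;> simp [h0]

lemma sub_killPositive_mem {σ : PointedCone ℝ (ℝ ⊗[ℤ] N)} {n : N} (h : Supports σ n)
    {I : Ideal (coneRing σ)} (hI : ∀ m : dualMonoid σ, m.1 n ≠ 0 → character m ∈ I)
    (a : coneRing σ) : a - killPositive h a ∈ I := by
  classical
  induction a using AddMonoidAlgebra.induction_linear with
  | zero => simp
  | add f g hf hg =>
    rw [map_add, add_sub_add_comm]
    exact add_mem hf hg
  | single m c =>
    rw [killPositive_single]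
    split_ifs with h0
    · simp
    · have : AddMonoidAlgebra.single m c = AddMonoidAlgebra.single 0 c * character m := by
        simp [character, AddMonoidAlgebra.single_mul_single]
      rw [sub_zero, this]
      exact Ideal.mul_mem_left _ _ (hI m h0)

lemma rayIdeal_le {σ : PointedCone ℝ (ℝ ⊗[ℤ] N)} {n : N} (h : Supports σ n)
    {I : Ideal (coneRing σ)} (hI : ∀ m : dualMonoid σ, m.1 n ≠ 0 → character m ∈ I) :
    rayIdeal h ≤ I := by
  intro a ha
  have := sub_killPositive_mem h hI a
  rwa [show killPositive h a = 0 from ha, sub_zero] at this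

lemma character_add {σ : PointedCone ℝ (ℝ ⊗[ℤ] N)} (m m' : dualMonoid σ) :
    character (m + m') = character m * character m' := by
  simp [character, AddMonoidAlgebra.single_mul_single]

lemma character_zero {σ : PointedCone ℝ (ℝ ⊗[ℤ] N)} :
    character (0 : dualMonoid σ) = 1 := rfl

lemma coneRingMap_character {τ σ : PointedCone ℝ (ℝ ⊗[ℤ] N)} (h : τ ≤ σ) (m : dualMonoid σ) :
    coneRingMap h (character m) = character (AddSubmonoid.inclusion (dualMonoid_anti h) m) :=
  coneRingMap_single h m 1

namespace SmoothFan

variable {Δ : SmoothFan N}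

lemma Ray.supports {ρ : Δ.Ray} {σ : Δ.Cone} (h : ρ.1 ≤ σ) : Supports σ.1 ρ.generator :=
  fun _ hm => (mem_dualMonoid_iff σ).1 hm ρ h

/-- In the coordinate ring of a smooth cone the ideal of a ray is principal, generated by the
character dual to the ray. -/
lemma rayIdeal_eq_span {σ : Δ.Cone} {ρ : Δ.Ray} (h : ρ.1 ≤ σ) {m : dualMonoid σ.1}
    (h1 : m.1 ρ.generator = 1)
    (h0 : ∀ ρ' : Δ.Ray, ρ'.1 ≤ σ → ρ' ≠ ρ → m.1 ρ'.generator = 0) :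
    rayIdeal (Ray.supports h) = Ideal.span {character m} := by
  apply le_antisymm
  · refine rayIdeal_le _ fun u hu => ?_
    have hmem : u.1 - m.1 ∈ dualMonoid σ.1 := by
      rw [mem_dualMonoid_iff]
      intro ρ' hρ'
      have hu' := (mem_dualMonoid_iff σ).1 u.2 ρ' hρ'
      rw [LinearMap.sub_apply]
      by_cases e : ρ' = ρ
      · subst e
        rw [h1]; omega
      · rw [h0 ρ' hρ' e]; omega
    have : u = ⟨_, hmem⟩ + m := Subtype.ext (sub_add_cancel _ _).symm
    rw [this, character_add]
    exact Ideal.mul_mem_left _ _ (Ideal.mem_span_singleton_self _)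
  · rw [Ideal.span_singleton_le_iff_mem, character_mem_rayIdeal, h1]
    exact one_ne_zero

end SmoothFan

end ConeRings

/-! ### The affine charts of the toric variety -/

namespace SmoothFan

variable {N : Type} [AddCommGroup N] (Δ : SmoothFan N)

/-- The open embedding of `Spec ℂ[M ∩ σ^∨]` into `X` on points. -/
def chartMap (σ : Δ.Cone) (p : PrimeSpectrum (coneRing σ.1)) : Δ.toricVariety := Δ.chart σ p

/-- The affine chart `U_σ`, as an open subset of `X`. -/
abbrev chartOpens (σ : Δ.Cone) : Δ.toricVariety.Opens := Δ.chart σ ''ᵁ ⊤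

/-- The functions on `U_σ` given by elements of `ℂ[M ∩ σ^∨]`. -/
def chartFunction (σ : Δ.Cone) : coneRing σ.1 →+* Γ(Δ.toricVariety, Δ.chartOpens σ) :=
  ((Scheme.ΓSpecIso (.of (coneRing σ.1))).inv ≫ ((Δ.chart σ).appIso ⊤).inv).hom

lemma chartFunction_bijective (σ : Δ.Cone) : Function.Bijective (Δ.chartFunction σ) :=
  ConcreteCategory.bijective_of_isIso
    ((Scheme.ΓSpecIso (.of (coneRing σ.1))).inv ≫ ((Δ.chart σ).appIso ⊤).inv)

variable {Δ}

lemma mem_chartOpens {σ : Δ.Cone} {x : Δ.toricVariety} :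
    x ∈ Δ.chartOpens σ ↔ ∃ p, Δ.chartMap σ p = x := by
  constructor
  · rintro ⟨p, -, rfl⟩
    exact ⟨p, rfl⟩
  · rintro ⟨p, rfl⟩
    exact ⟨p, trivial, rfl⟩

lemma isOpenEmbedding_chartMap (σ : Δ.Cone) : Topology.IsOpenEmbedding (Δ.chartMap σ) :=
  (Δ.chart σ).isOpenEmbedding

lemma isAffineOpen_chartOpens (σ : Δ.Cone) : IsAffineOpen (Δ.chartOpens σ) :=
  (isAffineOpen_top _).image_of_isOpenImmersion _

lemma exists_mem_chartOpens (x : Δ.toricVariety) : ∃ σ, x ∈ Δ.chartOpens σ := by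
  obtain ⟨σ, p, hp⟩ := Scheme.IsLocallyDirected.ι_jointly_surjective Δ.affineDiagram x
  exact ⟨σ, mem_chartOpens.2 ⟨p, hp⟩⟩

lemma map_chart {τ σ : Δ.Cone} (h : τ ≤ σ) :
    Spec.map (CommRingCat.ofHom (coneRingMap h)) ≫ Δ.chart σ = Δ.chart τ :=
  colimit.w Δ.affineDiagram (homOfLE h)

lemma chartMap_comap {τ σ : Δ.Cone} (h : τ ≤ σ) (p : PrimeSpectrum (coneRing τ.1)) :
    Δ.chartMap σ (PrimeSpectrum.comap (coneRingMap h) p) = Δ.chartMap τ p := by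
  rw [chartMap, chartMap, ← map_chart h]
  rfl

lemma chartOpens_mono {τ σ : Δ.Cone} (h : τ ≤ σ) : Δ.chartOpens τ ≤ Δ.chartOpens σ := by
  intro x hx
  obtain ⟨p, rfl⟩ := mem_chartOpens.1 hx
  exact mem_chartOpens.2 ⟨_, chartMap_comap h p⟩

/-- The intersection of two cones of a fan. -/
def infCone (σ τ : Δ.Cone) : Δ.Cone :=
  ⟨σ.1 ⊓ τ.1, Δ.face_mem _ σ.2 _ (Δ.inf_isFaceOf _ σ.2 _ τ.2)⟩

lemma infCone_le_left (σ τ : Δ.Cone) : infCone σ τ ≤ σ :=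
  show σ.1 ⊓ τ.1 ≤ σ.1 from inf_le_left

lemma infCone_le_right (σ τ : Δ.Cone) : infCone σ τ ≤ τ :=
  show σ.1 ⊓ τ.1 ≤ τ.1 from inf_le_right

lemma mem_chartOpens_infCone {σ τ : Δ.Cone} {x : Δ.toricVariety} :
    x ∈ Δ.chartOpens (infCone σ τ) ↔ x ∈ Δ.chartOpens σ ∧ x ∈ Δ.chartOpens τ := by
  constructor
  · exact fun h => ⟨chartOpens_mono (infCone_le_left σ τ) h,
      chartOpens_mono (infCone_le_right σ τ) h⟩
  · rintro ⟨h1, h2⟩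
    obtain ⟨p, rfl⟩ := mem_chartOpens.1 h1
    obtain ⟨q, hq⟩ := mem_chartOpens.1 h2
    obtain ⟨k, fi, fj, z, h3, -⟩ :=
      (Scheme.IsLocallyDirected.ι_eq_ι_iff Δ.affineDiagram).1 hq.symm
    have hk : k ≤ infCone σ τ :=
      show k.1 ≤ σ.1 ⊓ τ.1 from le_inf (leOfHom fi) (leOfHom fj)
    refine chartOpens_mono hk (mem_chartOpens.2 ⟨z, ?_⟩)
    rw [← h3]
    exact (chartMap_comap (leOfHom fi) z).symm

lemma chartMap_mem_chartOpens (σ : Δ.Cone) (p : PrimeSpectrum (coneRing σ.1)) :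
    Δ.chartMap σ p ∈ Δ.chartOpens σ := mem_chartOpens.2 ⟨p, rfl⟩

lemma basicOpen_chartFunction (σ : Δ.Cone) (a : coneRing σ.1) :
    Δ.toricVariety.basicOpen (Δ.chartFunction σ a) =
      Δ.chart σ ''ᵁ PrimeSpectrum.basicOpen a := by
  have h := Scheme.image_basicOpen (Δ.chart σ)
    (U := ⊤) ((Scheme.ΓSpecIso (.of (coneRing σ.1))).inv a)
  rw [basicOpen_eq_of_affine'] at h
  simp only [Iso.inv_hom_id_apply] at h
  exact h.symm

lemma isUnit_germ_chartFunction_iff (σ : Δ.Cone) (a : coneRing σ.1)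
    (p : PrimeSpectrum (coneRing σ.1)) (hp : Δ.chartMap σ p ∈ Δ.chartOpens σ) :
    IsUnit (Δ.toricVariety.presheaf.germ (Δ.chartOpens σ) (Δ.chartMap σ p) hp
      (Δ.chartFunction σ a)) ↔ a ∉ p.asIdeal := by
  rw [← Scheme.mem_basicOpen, basicOpen_chartFunction]
  constructor
  · rintro ⟨q, hq, h⟩
    rw [← (isOpenEmbedding_chartMap σ).injective h]
    exact hq
  · exact fun h => ⟨p, h, rfl⟩

/-- Every germ at a point of `U_σ` is a quotient of elements of `ℂ[M ∩ σ^∨]`. -/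
lemma exists_germ_mul_eq {σ : Δ.Cone} {x : Δ.toricVariety} (hx : x ∈ Δ.chartOpens σ)
    (g : Δ.toricVariety.presheaf.stalk x) :
    ∃ a s : coneRing σ.1,
      IsUnit (Δ.toricVariety.presheaf.germ (Δ.chartOpens σ) x hx (Δ.chartFunction σ s)) ∧
      Δ.toricVariety.presheaf.germ (Δ.chartOpens σ) x hx (Δ.chartFunction σ s) * g =
      Δ.toricVariety.presheaf.germ (Δ.chartOpens σ) x hx (Δ.chartFunction σ a) := by
  have hloc := (isAffineOpen_chartOpens σ).isLocalization_stalk ⟨x, hx⟩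
  let M := ((isAffineOpen_chartOpens σ).primeIdealOf ⟨x, hx⟩).asIdeal.primeCompl
  let _ : Algebra Γ(Δ.toricVariety, Δ.chartOpens σ) (Δ.toricVariety.presheaf.stalk x) :=
    TopCat.Presheaf.algebra_section_stalk Δ.toricVariety.presheaf (U := Δ.chartOpens σ) ⟨x, hx⟩
  obtain ⟨⟨a, s⟩, h⟩ := IsLocalization.surj M g
  obtain ⟨a', ha'⟩ := (Δ.chartFunction_bijective σ).2 a
  obtain ⟨s', hs'⟩ := (Δ.chartFunction_bijective σ).2 s.1
  refine ⟨a', s', ?_, ?_⟩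
  · rw [hs']
    exact IsLocalization.map_units (M := M) _ s
  · rw [hs', ha', mul_comm]
    exact h

lemma appLE_chartFunction (σ : Δ.Cone) (a : coneRing σ.1) :
    (Δ.chart σ).appLE (Δ.chartOpens σ) ⊤ ((Δ.chart σ).preimage_image_eq ⊤).ge
      (Δ.chartFunction σ a) = (Scheme.ΓSpecIso (.of (coneRing σ.1))).inv a := by
  change (((Δ.chart σ).appIso ⊤).inv ≫ (Δ.chart σ).appLE _ _ _)
    ((Scheme.ΓSpecIso (.of (coneRing σ.1))).inv a) = _
  rw [Scheme.Hom.appIso_inv_appLE]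
  exact ConcreteCategory.congr_hom ((Spec (.of (coneRing σ.1))).presheaf.map_id _) _

/-- The function on `U_τ` given by the image of `a` is the restriction of the function on `U_σ`
given by `a`. -/
lemma map_chartFunction {τ σ : Δ.Cone} (h : τ ≤ σ) (a : coneRing σ.1) :
    Δ.toricVariety.presheaf.map (homOfLE (chartOpens_mono h)).op (Δ.chartFunction σ a) =
      Δ.chartFunction τ (coneRingMap h a) := by
  have hinj : Function.Injective ((Δ.chart τ).appLE (Δ.chartOpens τ) ⊤
      ((Δ.chart τ).preimage_image_eq ⊤).ge) := by
    rw [← Scheme.Hom.appIso_hom']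
    exact (ConcreteCategory.bijective_of_isIso ((Δ.chart τ).appIso ⊤).hom).1
  apply hinj
  rw [appLE_chartFunction, ← ConcreteCategory.comp_apply, Scheme.Hom.map_appLE]
  simp only [← map_chart h]
  rw [← Scheme.Hom.appLE_comp_appLE (Spec.map (CommRingCat.ofHom (coneRingMap h))) (Δ.chart σ)
    (Δ.chartOpens σ) ⊤ ⊤ ((Δ.chart σ).preimage_image_eq ⊤).ge le_top, ConcreteCategory.comp_apply,
    appLE_chartFunction]
  exact (ConcreteCategory.congr_hom (Scheme.ΓSpecIso_inv_naturality
    (CommRingCat.ofHom (coneRingMap h))) a).symm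

end SmoothFan

/-! ### Local equations of the divisors `V(ρ)` -/

lemma mem_vanishingIdeal_iff {X : Scheme.{0}} {Z : TopologicalSpace.Closeds X} {U : X.affineOpens}
    {g : Γ(X, U)} :
    g ∈ (Scheme.IdealSheafData.vanishingIdeal Z).ideal U ↔
      ∀ x ∈ Z, ∀ hx : x ∈ U.1, ¬ IsUnit (X.presheaf.germ U.1 x hx g) := by
  have hb : ∀ p, p ∈ PrimeSpectrum.basicOpen g ↔ U.2.fromSpec p ∈ X.basicOpen g := by
    intro p
    have := U.2.fromSpec_preimage_basicOpen g
    exact (SetLike.ext_iff.1 this p).symm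
  change g ∈ PrimeSpectrum.vanishingIdeal _ ↔ _
  rw [PrimeSpectrum.mem_vanishingIdeal]
  constructor
  · intro h x hxZ hx
    have hr : x ∈ Set.range U.2.fromSpec := by rw [U.2.range_fromSpec]; exact hx
    obtain ⟨p, rfl⟩ := hr
    rw [← Scheme.mem_basicOpen]
    exact fun h' => (hb p).2 h' (h p hxZ)
  · intro h p hp
    by_contra hc
    have hx : U.2.fromSpec p ∈ U.1 := by
      have : U.2.fromSpec p ∈ Set.range U.2.fromSpec := ⟨p, rfl⟩
      rwa [U.2.range_fromSpec] at this
    refine h _ hp hx ?_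
    rw [← Scheme.mem_basicOpen]
    exact (hb p).1 hc

lemma idealStalk_eq_top {X : Scheme.{0}} {Z : TopologicalSpace.Closeds X} {x : X} (hx : x ∉ Z) :
    idealStalk Z x = ⊤ := by
  obtain ⟨_, ⟨U, hU, rfl⟩, hxU, hUZ⟩ :=
    X.isBasis_affineOpens.exists_subset_of_mem_open (show x ∈ (Z : Set X)ᶜ from hx)
      Z.isClosed.isOpen_compl
  rw [Ideal.eq_top_iff_one]
  have h1 : (1 : Γ(X, U)) ∈ (Scheme.IdealSheafData.vanishingIdeal Z).ideal ⟨U, hU⟩ :=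
    mem_vanishingIdeal_iff.2 fun y hyZ hy => absurd hyZ (hUZ hy)
  have h2 : (1 : X.presheaf.stalk x) ∈ Ideal.map (X.presheaf.germ U x hxU).hom
      ((Scheme.IdealSheafData.vanishingIdeal Z).ideal ⟨U, hU⟩) := by
    rw [← map_one (X.presheaf.germ U x hxU).hom]
    exact Ideal.mem_map_of_mem _ h1
  exact (le_iSup₂ (f := fun (U : X.affineOpens) (h : x ∈ U.1) =>
    Ideal.map (X.presheaf.germ U.1 x h).hom
      ((Scheme.IdealSheafData.vanishingIdeal Z).ideal U)) ⟨U, hU⟩ hxU) h2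

namespace SmoothFan

variable {N : Type} [AddCommGroup N] {Δ : SmoothFan N}

/-- The prime ideal of the ray `ρ` as a point of `Spec ℂ[M ∩ σ^∨]`. -/
def Ray.chartPoint {ρ : Δ.Ray} {σ : Δ.Cone} (h : ρ.1 ≤ σ) : PrimeSpectrum (coneRing σ.1) :=
  ⟨rayIdeal (Ray.supports h), inferInstance⟩

/-- The generic point of the divisor `V(ρ)`. -/
def Ray.divisorPoint (ρ : Δ.Ray) : Δ.toricVariety := Δ.chartMap ρ.1 (Ray.chartPoint le_rfl)

lemma Ray.chartMap_chartPoint {ρ : Δ.Ray} {σ : Δ.Cone} (h : ρ.1 ≤ σ) :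
    Δ.chartMap σ (Ray.chartPoint h) = ρ.divisorPoint := by
  rw [Ray.divisorPoint, ← chartMap_comap h]
  congr 1
  exact PrimeSpectrum.ext (comap_rayIdeal (Ray.supports le_rfl) (Ray.supports h) h).symm

lemma chartMap_specializes_iff (σ : Δ.Cone) (p q : PrimeSpectrum (coneRing σ.1)) :
    Δ.chartMap σ p ⤳ Δ.chartMap σ q ↔ p.asIdeal ≤ q.asIdeal := by
  rw [(isOpenEmbedding_chartMap σ).isInducing.specializes_iff]
  exact (PrimeSpectrum.le_iff_specializes p q).symm

/-- The divisor `V(ρ)` is irreducible, with generic point `ρ.divisorPoint`. -/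
lemma Ray.mem_divisor_iff_specializes {ρ : Δ.Ray} {x : Δ.toricVariety} :
    x ∈ ρ.divisor ↔ ρ.divisorPoint ⤳ x := by
  have horb : ρ.divisorPoint ∈ orbit ρ.1 := by
    refine ⟨Ray.chartPoint le_rfl, ?_, rfl⟩
    rintro m ⟨v, hv, hne⟩
    rw [Ray.chartPoint, character_mem_rayIdeal]
    intro h0
    rw [ρ.generator_spec.2, latticeCone, Set.image_singleton] at hv
    obtain ⟨r, rfl⟩ := Submodule.mem_span_singleton.1 hv
    refine hne ((pairing_smul m.1 r.1 _).trans ?_)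
    simp [h0]
  have hsub : orbit ρ.1 ⊆ closure {ρ.divisorPoint} := by
    rintro _ ⟨p, hp, rfl⟩
    change Δ.chartMap ρ.1 p ∈ _
    rw [← specializes_iff_mem_closure]
    refine (chartMap_specializes_iff ρ.1 _ p).2 ?_
    refine rayIdeal_le _ fun m hm => hp m ⟨_, ρ.generator_mem, ?_⟩
    simpa using hm
  rw [specializes_iff_mem_closure]
  change x ∈ closure (orbit ρ.1) ↔ _
  constructor
  · exact fun h => closure_minimal hsub isClosed_closure h
  · exact fun h => closure_mono (Set.singleton_subset_iff.2 horb) h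

lemma Ray.chartMap_mem_divisor_iff {ρ : Δ.Ray} {σ : Δ.Cone} (h : ρ.1 ≤ σ)
    (p : PrimeSpectrum (coneRing σ.1)) :
    Δ.chartMap σ p ∈ ρ.divisor ↔ rayIdeal (Ray.supports h) ≤ p.asIdeal := by
  rw [Ray.mem_divisor_iff_specializes, ← Ray.chartMap_chartPoint h, chartMap_specializes_iff]
  rfl

/-- A chart `U_τ ⊆ U_σ` is the locus where a single character is invertible. -/
lemma exists_character_cutting {τ σ : Δ.Cone} (h : τ ≤ σ) :
    ∃ m : dualMonoid σ.1, (∀ ρ : Δ.Ray, ρ.1 ≤ σ → (m.1 ρ.generator = 0 ↔ ρ.1 ≤ τ)) ∧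
      ∀ x (hx : x ∈ Δ.chartOpens σ), x ∈ Δ.chartOpens τ ↔
        IsUnit (Δ.toricVariety.presheaf.germ (Δ.chartOpens σ) x hx
          (Δ.chartFunction σ (character m))) := by
  obtain ⟨m, hm, -, hr⟩ := exists_range_eq (homOfLE h)
  refine ⟨m, fun ρ hρ => ?_, fun x hx => ?_⟩
  · have : ρ.1 ≤ τ ↔ _ := Ray.le_iff (ρ := ρ) (σ := τ.1)
    rw [this, hm]
    simp [Ray.le_iff.1 (show ρ.1.1 ≤ σ.1 from hρ)]
  · obtain ⟨p, rfl⟩ := mem_chartOpens.1 hx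
    refine Iff.trans ?_ (isUnit_germ_chartFunction_iff σ (character m) p hx).symm
    have h1 : p ∈ Set.range (Δ.affineDiagram.map (homOfLE h)) ↔
        character m ∉ p.asIdeal := by rw [hr]; rfl
    rw [← h1, mem_chartOpens]
    constructor
    · rintro ⟨q, hq⟩
      refine ⟨q, (isOpenEmbedding_chartMap σ).injective ?_⟩
      rw [← hq]
      exact chartMap_comap h q
    · rintro ⟨q, rfl⟩
      exact ⟨q, (chartMap_comap h q).symm⟩

/-- The divisor `V(ρ)` does not meet the charts of the cones that do not contain `ρ`. -/
lemma Ray.notMem_divisor {ρ : Δ.Ray} {σ : Δ.Cone} (h : ¬ ρ.1 ≤ σ) {x : Δ.toricVariety}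
    (hx : x ∈ Δ.chartOpens σ) : x ∉ ρ.divisor := by
  intro hxd
  rw [Ray.mem_divisor_iff_specializes] at hxd
  have h1 : ρ.divisorPoint ∈ Δ.chartOpens σ := hxd.mem_open (Δ.chartOpens σ).isOpen hx
  have h2 : ρ.divisorPoint ∈ Δ.chartOpens ρ.1 := chartMap_mem_chartOpens _ _
  obtain ⟨m, hm, hU⟩ := exists_character_cutting (infCone_le_right σ ρ.1)
  have h3 := (isUnit_germ_chartFunction_iff _ _ _ h2).1
    ((hU _ h2).1 (mem_chartOpens_infCone.2 ⟨h1, h2⟩))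
  rw [Ray.chartPoint, character_mem_rayIdeal, not_not, hm _ le_rfl] at h3
  exact h (h3.trans (infCone_le_left σ ρ.1))

/-- The local equation of the divisor `V(ρ)` on the chart `U_σ` is the character dual to the
ray. -/
lemma idealStalk_divisor {ρ : Δ.Ray} {σ : Δ.Cone} (h : ρ.1 ≤ σ) {m : dualMonoid σ.1}
    (h1 : m.1 ρ.generator = 1)
    (h0 : ∀ ρ' : Δ.Ray, ρ'.1 ≤ σ → ρ' ≠ ρ → m.1 ρ'.generator = 0)
    {x : Δ.toricVariety} (hx : x ∈ Δ.chartOpens σ) :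
    idealStalk ρ.divisor x = Ideal.span {Δ.toricVariety.presheaf.germ (Δ.chartOpens σ) x hx
      (Δ.chartFunction σ (character m))} := by
  have hspan := rayIdeal_eq_span h h1 h0
  have hpt : ∀ q : PrimeSpectrum (coneRing σ.1),
      Δ.chartMap σ q ∈ ρ.divisor ↔ character m ∈ q.asIdeal := by
    intro q
    rw [Ray.chartMap_mem_divisor_iff h, hspan, Ideal.span_singleton_le_iff_mem]
  obtain ⟨p, rfl⟩ := mem_chartOpens.1 hx
  apply le_antisymm
  · by_cases hp : character m ∈ p.asIdeal
    · refine iSup₂_le fun U hxU => ?_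
      rw [Ideal.map_le_iff_le_comap]
      intro g hg
      rw [mem_vanishingIdeal_iff] at hg
      rw [Ideal.mem_comap]
      -- `g` is a fraction `a / s`, and vanishing of `g` at the generic point of `V(ρ)` means that `a`
      -- lies in the ideal of the ray.
      obtain ⟨a, s, hs, has⟩ := exists_germ_mul_eq hx
        (Δ.toricVariety.presheaf.germ U.1 (Δ.chartMap σ p) hxU g)
      have hspec : ρ.divisorPoint ⤳ Δ.chartMap σ p :=
        Ray.mem_divisor_iff_specializes.1 ((hpt p).2 hp)
      have hd1 : ρ.divisorPoint ∈ U.1 := hspec.mem_open U.1.isOpen hxU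
      have hd2 : ρ.divisorPoint ∈ Δ.chartOpens σ := hspec.mem_open (Δ.chartOpens σ).isOpen hx
      have hnu := hg _ (Ray.mem_divisor_iff_specializes.2 specializes_rfl) hd1
      have ha : a ∈ rayIdeal (Ray.supports h) := by
        have e := congrArg (Δ.toricVariety.presheaf.stalkSpecializes hspec) has
        rw [map_mul, TopCat.Presheaf.germ_stalkSpecializes_apply,
          TopCat.Presheaf.germ_stalkSpecializes_apply,
          TopCat.Presheaf.germ_stalkSpecializes_apply] at e
        by_contra hc
        have hd3 : Δ.chartMap σ (Ray.chartPoint h) ∈ Δ.chartOpens σ := chartMap_mem_chartOpens _ _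
        have hu := (isUnit_germ_chartFunction_iff σ a (Ray.chartPoint h) hd3).2 hc
        have e' : Δ.chartMap σ (Ray.chartPoint h) = ρ.divisorPoint := Ray.chartMap_chartPoint h
        have hu' : IsUnit (Δ.toricVariety.presheaf.germ (Δ.chartOpens σ) ρ.divisorPoint hd2
            (Δ.chartFunction σ a)) := by
          rw [← Scheme.mem_basicOpen] at hu ⊢
          rwa [← e']
        rw [← e] at hu'
        exact hnu (isUnit_of_mul_isUnit_right hu')
      rw [hspan, Ideal.mem_span_singleton] at ha
      obtain ⟨c, rfl⟩ := ha
      rw [Ideal.mem_span_singleton]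
      refine (hs.dvd_mul_left).1 ⟨Δ.toricVariety.presheaf.germ (Δ.chartOpens σ) _ hx
        (Δ.chartFunction σ c), ?_⟩
      refine has.trans ?_
      rw [map_mul, map_mul]
    · have hu := (isUnit_germ_chartFunction_iff σ (character m) p hx).2 hp
      rw [Ideal.span_singleton_eq_top.2 hu]
      exact le_top
  · rw [Ideal.span_singleton_le_iff_mem]
    have hg : Δ.chartFunction σ (character m) ∈
        (Scheme.IdealSheafData.vanishingIdeal ρ.divisor).ideal
          ⟨Δ.chartOpens σ, isAffineOpen_chartOpens σ⟩ := by
      rw [mem_vanishingIdeal_iff]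
      intro y hyZ hy
      obtain ⟨q, rfl⟩ := mem_chartOpens.1 hy
      exact fun hu => (isUnit_germ_chartFunction_iff σ (character m) q hy).1 hu ((hpt q).1 hyZ)
    exact (le_iSup₂ (f := fun (U : Δ.toricVariety.affineOpens) (h : Δ.chartMap σ p ∈ U.1) =>
      Ideal.map (Δ.toricVariety.presheaf.germ U.1 _ h).hom
        ((Scheme.IdealSheafData.vanishingIdeal ρ.divisor).ideal U))
          ⟨Δ.chartOpens σ, isAffineOpen_chartOpens σ⟩ hx) (Ideal.mem_map_of_mem _ hg)

end SmoothFan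

/-! ### Height one primes of normal Noetherian domains -/

section HeightOne

variable {R : Type*} [CommRing R] [IsDomain R] [IsNoetherianRing R]

/-- An associated prime `P` of a proper principal ideal of a normal Noetherian domain has height
one: write `P = ((b) : c)`; since `c / b` is not integral, it maps some `p ∈ P` out of `P`, and then
`P` is minimal over `(p)`. -/
lemma height_eq_one_of_forall_mem_iff [IsIntegrallyClosed R] {P : Ideal R} [P.IsPrime] {b c : R}
    (hb : b ≠ 0) (hP : ∀ r, r ∈ P ↔ b ∣ r * c) : P.height = 1 := by
  let K := FractionRing R
  have hinj := IsFractionRing.injective R K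
  have hbK : algebraMap R K b ≠ 0 := fun h => hb (hinj (by rw [h, map_zero]))
  have hbP : b ∈ P := (hP b).2 (dvd_mul_right _ _)
  have hPbot : P ≠ ⊥ := fun h => hb (by rw [h] at hbP; simpa using hbP)
  obtain ⟨p, hp, u, hu, hpu⟩ : ∃ p ∈ P, ∃ u, u ∉ P ∧ p * c = b * u := by
    by_contra! hcon
    let x : K := algebraMap R K c / algebraMap R K b
    let M := Submodule.map (Algebra.linearMap R K) P
    have hint : IsIntegral R x := by
      refine isIntegral_of_smul_mem_submodule M ?_ ?_ x ?_
      · rw [Submodule.ne_bot_iff]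
        exact ⟨_, ⟨b, hbP, rfl⟩, hbK⟩
      · exact Submodule.FG.map _ (IsNoetherian.noetherian _)
      · rintro _ ⟨p, hp, rfl⟩
        obtain ⟨u, hu⟩ := (hP p).1 hp
        refine ⟨u, by_contra fun h => hcon p hp u h hu, ?_⟩
        simp only [Algebra.linearMap_apply, smul_eq_mul, x]
        rw [div_mul_eq_mul_div, eq_div_iff hbK, ← map_mul, ← map_mul, mul_comm u, ← hu, mul_comm]
    obtain ⟨y, hy⟩ := IsIntegrallyClosed.algebraMap_eq_of_integral hint
    rw [eq_div_iff hbK, ← map_mul] at hy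
    have : (1 : R) ∈ P := (hP 1).2 ⟨y, by rw [one_mul, ← hinj hy, mul_comm]⟩
    exact Ideal.IsPrime.ne_top' ((Ideal.eq_top_iff_one P).2 this)
  have hmin : P ∈ (Ideal.span {p}).minimalPrimes := by
    refine ⟨⟨inferInstance, by rwa [Ideal.span_singleton_le_iff_mem]⟩, ?_⟩
    rintro Q ⟨hQ, hpQ⟩ hQP q hq
    rw [Ideal.span_singleton_le_iff_mem] at hpQ
    obtain ⟨k, hk⟩ := (hP q).1 hq
    have h1 : b * (q * u) = b * (k * p) := by
      calc b * (q * u) = q * (b * u) := by ring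
        _ = p * (q * c) := by rw [← hpu]; ring
        _ = b * (k * p) := by rw [hk]; ring
    have h2 : q * u ∈ Q := by
      rw [mul_left_cancel₀ hb h1]
      exact Q.mul_mem_left _ hpQ
    exact (hQ.mem_or_mem h2).resolve_right fun h => hu (hQP h)
  refine le_antisymm (Ideal.height_le_one_of_isPrincipal_of_mem_minimalPrimes _ P hmin) ?_
  rw [Order.one_le_iff_pos, pos_iff_ne_zero]
  intro h0
  exact hPbot (Ideal.height_eq_zero_iff_eq_bot.1 h0)

/-- A normal Noetherian domain is the intersection of its localizations at primes of height one. -/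
lemma mem_range_of_height_one [IsIntegrallyClosed R] {K : Type*} [Field K] [Algebra R K]
    [IsFractionRing R K] {x : K}
    (h : ∀ P : Ideal R, P.IsPrime → P.height = 1 →
      ∃ a s : R, s ∉ P ∧ x * algebraMap R K s = algebraMap R K a) :
    x ∈ Set.range (algebraMap R K) := by
  have hinj := IsFractionRing.injective R K
  obtain ⟨a, b, hb, rfl⟩ := IsFractionRing.div_surjective (A := R) x
  have hb0 : b ≠ 0 := nonZeroDivisors.ne_zero hb
  have hbK : algebraMap R K b ≠ 0 := fun h => hb0 (hinj (by rw [h, map_zero]))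
  by_cases hba : b ∣ a
  · obtain ⟨k, rfl⟩ := hba
    exact ⟨k, by rw [map_mul, mul_div_cancel_left₀ _ hbK]⟩
  exfalso
  have hne : Ideal.Quotient.mk (Ideal.span {b}) a ≠ 0 := by
    rwa [Ne, Ideal.Quotient.eq_zero_iff_mem, Ideal.mem_span_singleton]
  obtain ⟨P, hP, hle⟩ := exists_le_isAssociatedPrime_of_isNoetherianRing R _ hne
  obtain ⟨hprime, c', hc'⟩ := isAssociatedPrime_iff.1 hP
  obtain ⟨c, rfl⟩ := Ideal.Quotient.mk_surjective c'
  have key : ∀ r d : R, r ∈ (⊥ : Submodule R (R ⧸ Ideal.span {b})).colon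
      {Ideal.Quotient.mk (Ideal.span {b}) d} ↔ b ∣ r * d := by
    intro r d
    rw [Submodule.mem_colon_singleton, Submodule.mem_bot, ← Ideal.mem_span_singleton,
      ← Ideal.Quotient.eq_zero_iff_mem, map_mul]
    rfl
  have hh := height_eq_one_of_forall_mem_iff (P := P) hb0 (fun r => by rw [hc', key])
  obtain ⟨a', s, hs, e⟩ := h P hprime hh
  refine hs (hle ((key s a).2 ⟨a', hinj ?_⟩))
  rw [div_mul_eq_mul_div, div_eq_iff hbK] at e
  rw [map_mul, map_mul, mul_comm, e, mul_comm]

/-- By Krull's principal ideal theorem, a nonzero nonunit lies in a prime ideal of height one. -/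
lemma exists_height_one_mem {x : R} (hx0 : x ≠ 0) (hx : ¬ IsUnit x) :
    ∃ P : Ideal R, P.IsPrime ∧ P.height = 1 ∧ x ∈ P := by
  obtain ⟨P, hP⟩ := (Ideal.span {x}).nonempty_minimalPrimes (by simpa)
  have hprime := hP.1.1
  have hxP : x ∈ P := hP.1.2 (Ideal.mem_span_singleton_self x)
  refine ⟨P, hprime, le_antisymm
    (Ideal.height_le_one_of_isPrincipal_of_mem_minimalPrimes _ P hP) ?_, hxP⟩
  rw [Order.one_le_iff_pos, pos_iff_ne_zero]
  intro h0
  rw [Ideal.height_eq_zero_iff_eq_bot.1 h0] at hxP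
  exact hx0 (by simpa using hxP)

lemma isUnit_of_ord_eq_zero {R : Type*} [CommRing R] {x : R} (h : Ring.ord R x = 0) :
    IsUnit x := by
  rw [Ring.ord, Module.length_eq_zero_iff, Submodule.Quotient.subsingleton_iff] at h
  exact Ideal.span_singleton_eq_top.1 h

lemma isDiscreteValuationRing_of_ringKrullDim_eq_one {R : Type*} [CommRing R] [IsDomain R]
    [IsNoetherianRing R] [IsLocalRing R] [IsIntegrallyClosed R] (h : ringKrullDim R = 1) :
    IsDiscreteValuationRing R := by
  have hf : ¬ IsField R := fun hf => by
    rw [ringKrullDim_eq_zero_of_isField hf] at h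
    exact zero_ne_one h
  have : Ring.DimensionLEOne R := by
    have : Ring.KrullDimLE 1 R := by rw [Ring.krullDimLE_iff, h]; rfl
    exact ⟨fun {P} hP hprime => Ring.krullDimLE_one_iff_of_noZeroDivisors.1 this P hP hprime⟩
  have : IsDedekindDomain R := {}
  exact ((IsDiscreteValuationRing.TFAE R hf).out 0 2).2 this

end HeightOne

/-! ### Rational functions and their orders along prime divisors -/

section Stalks

variable {X : Scheme.{0}}

lemma fromSpecStalk_specializes (y : X) (p : Spec (X.presheaf.stalk y)) :
    X.fromSpecStalk y p ⤳ y := by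
  have : X.fromSpecStalk y p ∈ Set.range (X.fromSpecStalk y) := ⟨p, rfl⟩
  rwa [Scheme.range_fromSpecStalk] at this

lemma isUnit_stalkSpecializes_iff (y : X) (p : Spec (X.presheaf.stalk y))
    (a : X.presheaf.stalk y) :
    IsUnit (X.presheaf.stalkSpecializes (fromSpecStalk_specializes y p) a) ↔ a ∉ p.asIdeal := by
  obtain ⟨V, hV, α, rfl⟩ := X.presheaf.exists_germ_eq a
  have hz : X.fromSpecStalk y p ∈ V := (fromSpecStalk_specializes y p).mem_open V.isOpen hV
  rw [TopCat.Presheaf.germ_stalkSpecializes_apply, ← Scheme.mem_basicOpen]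
  have h1 := Scheme.preimage_basicOpen (X.fromSpecStalk y) α
  rw [Scheme.fromSpecStalk_app hV] at h1
  simp only [ConcreteCategory.comp_apply] at h1
  rw [Scheme.basicOpen_res, basicOpen_eq_of_affine] at h1
  have h2 := SetLike.ext_iff.1 h1 p
  change X.fromSpecStalk y p ∈ X.basicOpen α ↔ _ at h2
  rw [h2]
  exact ⟨fun h => h.2, fun h => ⟨hz, h⟩⟩

/-- Elements of the local ring at a generalization `z` of `y` are fractions of elements of the local
ring at `y` whose denominator is invertible at `z`. -/
lemma exists_mul_stalkSpecializes_eq {z y : X} (h : z ⤳ y) (g : X.presheaf.stalk z) :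
    ∃ a s : X.presheaf.stalk y, IsUnit (X.presheaf.stalkSpecializes h s) ∧
      g * X.presheaf.stalkSpecializes h s = X.presheaf.stalkSpecializes h a := by
  obtain ⟨_, ⟨U, hU, rfl⟩, hyU, -⟩ :=
    X.isBasis_affineOpens.exists_subset_of_mem_open (Set.mem_univ y) isOpen_univ
  have hzU : z ∈ U := h.mem_open U.2 hyU
  have hloc := hU.isLocalization_stalk ⟨z, hzU⟩
  let M := (hU.primeIdealOf ⟨z, hzU⟩).asIdeal.primeCompl
  let _ : Algebra Γ(X, U) (X.presheaf.stalk z) :=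
    TopCat.Presheaf.algebra_section_stalk X.presheaf (U := U) ⟨z, hzU⟩
  obtain ⟨⟨a, s⟩, e⟩ := IsLocalization.surj M g
  refine ⟨X.presheaf.germ U y hyU a, X.presheaf.germ U y hyU s.1, ?_, ?_⟩
  · rw [TopCat.Presheaf.germ_stalkSpecializes_apply]
    exact IsLocalization.map_units (M := M) _ s
  · rw [TopCat.Presheaf.germ_stalkSpecializes_apply, TopCat.Presheaf.germ_stalkSpecializes_apply]
    exact e

variable [IsIntegral X]

@[simp]
lemma algebraMap_stalkSpecializes {z y : X} (h : z ⤳ y) (a : X.presheaf.stalk y) :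
    algebraMap (X.presheaf.stalk z) X.functionField (X.presheaf.stalkSpecializes h a) =
      algebraMap (X.presheaf.stalk y) X.functionField a :=
  TopCat.Presheaf.stalkSpecializes_comp_apply X.presheaf
    (genericPoint_specializes z : genericPoint X ⤳ z) h a

lemma algebraMap_stalk_injective (y : X) :
    Function.Injective (algebraMap (X.presheaf.stalk y) X.functionField) :=
  IsFractionRing.injective _ _

/-- The prime ideals of the local ring at `y` correspond to generalizations of `y`, at which the
local ring is the localization at the prime ideal. -/
lemma exists_generalization (y : X) (P : Ideal (X.presheaf.stalk y)) [hP : P.IsPrime] :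
    ∃ z, ∃ h : z ⤳ y, Order.coheight z = P.height ∧
      ∀ a, IsUnit (X.presheaf.stalkSpecializes h a) ↔ a ∉ P := by
  let p : Spec (X.presheaf.stalk y) := (⟨P, hP⟩ : PrimeSpectrum _)
  have hu : ∀ a, IsUnit (X.presheaf.stalkSpecializes (fromSpecStalk_specializes y p) a) ↔ a ∉ P :=
    isUnit_stalkSpecializes_iff y p
  refine ⟨_, fromSpecStalk_specializes y p, ?_, hu⟩
  let _ := (X.presheaf.stalkSpecializes (fromSpecStalk_specializes y p)).hom.toAlgebra
  have : IsLocalization.AtPrime (X.presheaf.stalk (X.fromSpecStalk y p)) P := by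
    refine ⟨?_, ?_, ?_⟩
    · rintro ⟨s, hs⟩
      exact (hu s).2 hs
    · intro g
      obtain ⟨a, s, hs, e⟩ := exists_mul_stalkSpecializes_eq (fromSpecStalk_specializes y p) g
      exact ⟨(a, ⟨s, (hu s).1 hs⟩), e⟩
    · intro a b hab
      refine ⟨1, ?_⟩
      have : a = b := by
        apply algebraMap_stalk_injective y
        rw [← algebraMap_stalkSpecializes (fromSpecStalk_specializes y p) a,
          ← algebraMap_stalkSpecializes (fromSpecStalk_specializes y p) b]
        exact congrArg _ hab
      rw [this]
  have h := IsLocalization.AtPrime.ringKrullDim_eq_height P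
    (X.presheaf.stalk (X.fromSpecStalk y p))
  rw [ringKrullDim_stalk_eq_coheight] at h
  exact_mod_cast h

/-- A rational function that is regular at all points of `U` is a section over `U`. -/
lemma exists_section_of_forall_mem_range (U : X.Opens) [hU : Nonempty U] {g : X.functionField}
    (h : ∀ y ∈ U, g ∈ Set.range (algebraMap (X.presheaf.stalk y) X.functionField)) :
    ∃ s : Γ(X, U), X.germToFunctionField U s = g := by
  have h1 : ∀ y : U, ∃ V : X.Opens, ∃ hy : y.1 ∈ V, V ≤ U ∧ ∃ s : Γ(X, V),
      X.presheaf.germ V (genericPoint X) ((genericPoint_specializes y.1).mem_open V.isOpen hy) s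
        = g := by
    intro y
    obtain ⟨a, rfl⟩ := h y y.2
    obtain ⟨V, hV, s, rfl⟩ := X.presheaf.exists_germ_eq a
    refine ⟨V ⊓ U, ⟨hV, y.2⟩, inf_le_right,
      X.presheaf.map (homOfLE (inf_le_left : V ⊓ U ≤ V)).op s, ?_⟩
    rw [TopCat.Presheaf.germ_res_apply]
    exact (TopCat.Presheaf.germ_stalkSpecializes_apply X.presheaf hV
      (genericPoint_specializes y.1) s).symm
  choose V hV hVU s hs using h1
  obtain ⟨t, ht, -⟩ := X.sheaf.existsUnique_gluing' V U (fun y => homOfLE (hVU y))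
    (fun y hy => TopologicalSpace.Opens.mem_iSup.2 ⟨⟨y, hy⟩, hV ⟨y, hy⟩⟩) s (by
      intro y z
      have hη : genericPoint X ∈ V y ⊓ V z :=
        ⟨(genericPoint_specializes y.1).mem_open (V y).isOpen (hV y),
          (genericPoint_specializes z.1).mem_open (V z).isOpen (hV z)⟩
      apply germ_injective_of_isIntegral X (genericPoint X) hη
      have e1 := TopCat.Presheaf.germ_res_apply X.presheaf
        (TopologicalSpace.Opens.infLELeft (V y) (V z)) _ hη (s y)
      have e2 := TopCat.Presheaf.germ_res_apply X.presheaf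
        (TopologicalSpace.Opens.infLERight (V y) (V z)) _ hη (s z)
      exact (e1.trans (hs y)).trans (e2.trans (hs z)).symm)
  refine ⟨t, ?_⟩
  obtain ⟨y⟩ := hU
  rw [← hs y, ← ht y]
  exact (TopCat.Presheaf.germ_res_apply X.presheaf (homOfLE (hVU y)) _ _ t).symm

variable [IsLocallyNoetherian X]

/-- A nonzero germ is invertible at `y` as soon as it is invertible at all generalizations of `y` of
codimension one. -/
lemma isUnit_of_forall_coheight_eq_one {y : X} {a : X.presheaf.stalk y} (ha : a ≠ 0)
    (h : ∀ z (hz : z ⤳ y), Order.coheight z = 1 → IsUnit (X.presheaf.stalkSpecializes hz a)) :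
    IsUnit a := by
  by_contra hu
  obtain ⟨P, hP, hht, haP⟩ := exists_height_one_mem ha hu
  obtain ⟨z, hz, hzh, hzu⟩ := exists_generalization y P
  exact (hzu a).1 (h z hz (hzh.trans hht)) haP

/-- A rational function on a normal scheme is regular at `y` as soon as it is regular at all
generalizations of `y` of codimension one. -/
lemma mem_range_of_forall_coheight_eq_one {y : X} [IsIntegrallyClosed (X.presheaf.stalk y)]
    {g : X.functionField}
    (h : ∀ z, z ⤳ y → Order.coheight z = 1 →
      g ∈ Set.range (algebraMap (X.presheaf.stalk z) X.functionField)) :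
    g ∈ Set.range (algebraMap (X.presheaf.stalk y) X.functionField) := by
  refine mem_range_of_height_one fun P hP hht => ?_
  obtain ⟨z, hz, hzh, hzu⟩ := exists_generalization y P
  obtain ⟨g', rfl⟩ := h z hz (hzh.trans hht)
  obtain ⟨a, s, hs, e⟩ := exists_mul_stalkSpecializes_eq hz g'
  refine ⟨a, s, (hzu s).1 hs, ?_⟩
  rw [← algebraMap_stalkSpecializes hz s, ← map_mul, e, algebraMap_stalkSpecializes]

/-- On germs, the order of vanishing at a point of codimension one is the length of the quotient. -/
lemma exists_ord_eq {z : X} (hz : Order.coheight z = 1) {a : X.presheaf.stalk z} (ha : a ≠ 0) :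
    ∃ n : ℕ, Ring.ord (X.presheaf.stalk z) a = n ∧
      Scheme.ord (algebraMap (X.presheaf.stalk z) X.functionField a) z = n := by
  have : Ring.KrullDimLE 1 (X.presheaf.stalk z) := krullDimLE_of_coheight_le hz.le
  have hmem : a ∈ nonZeroDivisors (X.presheaf.stalk z) := mem_nonZeroDivisors_of_ne_zero ha
  obtain ⟨n, hn⟩ := ENat.ne_top_iff_exists.1 (Ring.ord_ne_top hmem)
  refine ⟨n, hn.symm, ?_⟩
  have ha' : algebraMap (X.presheaf.stalk z) X.functionField a ≠ 0 :=
    (map_ne_zero_iff _ (algebraMap_stalk_injective z)).2 ha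
  rw [Scheme.ord_eq_iff hz ha']
  change Ring.ordFrac (X.presheaf.stalk z) (algebraMap _ X.functionField a) = _
  rw [Ring.ordFrac_eq_ord (X.presheaf.stalk z) ha, Ring.ordMonoidWithZeroHom_eq_coe _ hmem hn.symm]

lemma isUnit_iff_ord_eq_zero {z : X} (hz : Order.coheight z = 1) {a : X.presheaf.stalk z}
    (ha : a ≠ 0) :
    IsUnit a ↔ Scheme.ord (algebraMap (X.presheaf.stalk z) X.functionField a) z = 0 := by
  obtain ⟨n, h1, h2⟩ := exists_ord_eq hz ha
  rw [h2]
  constructor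
  · intro h
    rw [Ring.ord_of_isUnit h] at h1
    exact_mod_cast h1.symm
  · intro h
    refine isUnit_of_ord_eq_zero ?_
    rw [h1]
    exact_mod_cast h

/-- A rational function of nonnegative order along a prime divisor of a normal scheme is regular at
its generic point, as the local ring there is a discrete valuation ring. -/
lemma mem_range_of_ord_nonneg {z : X} [IsIntegrallyClosed (X.presheaf.stalk z)]
    (hz : Order.coheight z = 1) {g : X.functionField} (hg : 0 ≤ Scheme.ord g z) :
    g ∈ Set.range (algebraMap (X.presheaf.stalk z) X.functionField) := by
  have : IsDiscreteValuationRing (X.presheaf.stalk z) :=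
    isDiscreteValuationRing_of_ringKrullDim_eq_one (by rw [ringKrullDim_stalk_eq_coheight, hz]; rfl)
  obtain ⟨a, b, hb, rfl⟩ := IsFractionRing.div_surjective (A := X.presheaf.stalk z) g
  have hb0 : b ≠ 0 := nonZeroDivisors.ne_zero hb
  have hbK : algebraMap (X.presheaf.stalk z) X.functionField b ≠ 0 :=
    (map_ne_zero_iff _ (algebraMap_stalk_injective z)).2 hb0
  by_cases ha0 : a = 0
  · exact ⟨0, by simp [ha0]⟩
  have haK : algebraMap (X.presheaf.stalk z) X.functionField a ≠ 0 :=
    (map_ne_zero_iff _ (algebraMap_stalk_injective z)).2 ha0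
  obtain ⟨n, hn1, hn2⟩ := exists_ord_eq hz ha0
  obtain ⟨k, hk1, hk2⟩ := exists_ord_eq hz hb0
  have hmul := Scheme.ord_mul (x := z) (div_ne_zero haK hbK) hbK
  rw [div_mul_cancel₀ _ hbK, hn2, hk2] at hmul
  have hle : Ring.ord (X.presheaf.stalk z) b ≤ Ring.ord (X.presheaf.stalk z) a := by
    rw [hn1, hk1]
    exact_mod_cast (by omega : k ≤ n)
  rw [Ring.ord_eq_addVal, Ring.ord_eq_addVal, IsDiscreteValuationRing.addVal_le_iff_dvd] at hle
  obtain ⟨c, rfl⟩ := hle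
  exact ⟨c, by rw [map_mul, mul_div_cancel_left₀ _ hbK]⟩

end Stalks

/-! ### Pull-back along a morphism meeting the torus -/

namespace SmoothFan

variable {N : Type} [AddCommGroup N] {Δ : SmoothFan N}

lemma zeroCone_le (σ : Δ.Cone) : Δ.zeroCone ≤ σ := show (⊥ : PointedCone ℝ _) ≤ σ.1 from bot_le

variable (Δ) in
/-- The character `e(m)` as an element of the coordinate ring of the torus. -/
def torusElement (m : Module.Dual ℤ N) : coneRing Δ.zeroCone.1 :=
  character ⟨m, mem_dualMonoid_bot m⟩

lemma torusElement_add (m m' : Module.Dual ℤ N) :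
    Δ.torusElement (m + m') = Δ.torusElement m * Δ.torusElement m' :=
  character_add (σ := Δ.zeroCone.1) ⟨m, mem_dualMonoid_bot m⟩ ⟨m', mem_dualMonoid_bot m'⟩

lemma torusElement_zero : Δ.torusElement 0 = 1 := rfl

lemma coneRingMap_zeroCone_character (σ : Δ.Cone) (m : dualMonoid σ.1) :
    coneRingMap (zeroCone_le σ) (character m) = Δ.torusElement m.1 :=
  coneRingMap_character _ m

section Pullback

variable {Y : Scheme.{0}} (f : Y ⟶ Δ.toricVariety)

/-- The germ at `y` of the pull-back of a function on the chart `U_σ`. -/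
def pullGerm (σ : Δ.Cone) (y : Y) (hy : f y ∈ Δ.chartOpens σ) :
    coneRing σ.1 →+* Y.presheaf.stalk y :=
  (f.stalkMap y).hom.comp ((Δ.toricVariety.presheaf.germ (Δ.chartOpens σ) (f y) hy).hom.comp
    (Δ.chartFunction σ))

lemma germ_app_chartFunction (σ : Δ.Cone) (y : Y) (hy : f y ∈ Δ.chartOpens σ) (a : coneRing σ.1) :
    Y.presheaf.germ (f ⁻¹ᵁ Δ.chartOpens σ) y hy (f.app (Δ.chartOpens σ) (Δ.chartFunction σ a)) =
      pullGerm f σ y hy a :=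
  (Scheme.Hom.germ_stalkMap_apply f (Δ.chartOpens σ) y hy (Δ.chartFunction σ a)).symm

lemma stalkSpecializes_pullGerm {σ τ : Δ.Cone} (h : τ ≤ σ) {z y : Y} (hzy : z ⤳ y)
    (hy : f y ∈ Δ.chartOpens σ) (hz : f z ∈ Δ.chartOpens τ) (a : coneRing σ.1) :
    Y.presheaf.stalkSpecializes hzy (pullGerm f σ y hy a) =
      pullGerm f τ z hz (coneRingMap h a) := by
  change Y.presheaf.stalkSpecializes hzy (f.stalkMap y _) = f.stalkMap z
    (Δ.toricVariety.presheaf.germ (Δ.chartOpens τ) (f z) hz (Δ.chartFunction τ (coneRingMap h a)))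
  refine (Scheme.Hom.stalkSpecializes_stalkMap_apply f z y hzy _).symm.trans ?_
  congr 1
  rw [← map_chartFunction h, TopCat.Presheaf.germ_res_apply]
  exact TopCat.Presheaf.germ_stalkSpecializes_apply _ _ _ _

lemma isUnit_pullGerm_iff (σ : Δ.Cone) (y : Y) (hy : f y ∈ Δ.chartOpens σ) (a : coneRing σ.1) :
    IsUnit (pullGerm f σ y hy a) ↔ IsUnit
      (Δ.toricVariety.presheaf.germ (Δ.chartOpens σ) (f y) hy (Δ.chartFunction σ a)) :=
  isUnit_map_iff (f.stalkMap y).hom _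

/-- In a chart containing `f y`, the pull-back of `V(ρ)` is cut out at `y` by the pull-back of the
character dual to `ρ`. -/
lemma pullbackMultiplicity_eq_ord {ρ : Δ.Ray} {σ : Δ.Cone} (h : ρ.1 ≤ σ) {m : dualMonoid σ.1}
    (h1 : m.1 ρ.generator = 1)
    (h0 : ∀ ρ' : Δ.Ray, ρ'.1 ≤ σ → ρ' ≠ ρ → m.1 ρ'.generator = 0)
    {y : Y} (hy : f y ∈ Δ.chartOpens σ) :
    pullbackMultiplicity f ρ.divisor y =
      Ring.ord (Y.presheaf.stalk y) (pullGerm f σ y hy (character m)) := by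
  rw [pullbackMultiplicity, idealStalk_divisor h h1 h0 hy, Ideal.map_span, Set.image_singleton]
  rfl

lemma pullbackMultiplicity_eq_zero {ρ : Δ.Ray} {σ : Δ.Cone} (h : ¬ ρ.1 ≤ σ)
    {y : Y} (hy : f y ∈ Δ.chartOpens σ) : pullbackMultiplicity f ρ.divisor y = 0 := by
  rw [pullbackMultiplicity, idealStalk_eq_top (Ray.notMem_divisor h hy), Ideal.map_top,
    Module.length_eq_zero_iff, Submodule.Quotient.subsingleton_iff]

variable [IsIntegral Y]

/-- The pull-back to the function field of `Y` of functions on the torus. -/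
def pullFunction (hη : f (genericPoint Y) ∈ Δ.torus) :
    coneRing Δ.zeroCone.1 →+* Y.functionField :=
  pullGerm f Δ.zeroCone (genericPoint Y) hη

variable {f} (hη : f (genericPoint Y) ∈ Δ.torus)

lemma algebraMap_pullGerm (σ : Δ.Cone) (y : Y) (hy : f y ∈ Δ.chartOpens σ) (a : coneRing σ.1) :
    algebraMap (Y.presheaf.stalk y) Y.functionField (pullGerm f σ y hy a) =
      pullFunction f hη (coneRingMap (zeroCone_le σ) a) :=
  stalkSpecializes_pullGerm f (zeroCone_le σ) (genericPoint_specializes y) hy hη a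

lemma algebraMap_pullGerm_character {σ : Δ.Cone} {y : Y} (hy : f y ∈ Δ.chartOpens σ)
    (m : dualMonoid σ.1) :
    algebraMap (Y.presheaf.stalk y) Y.functionField (pullGerm f σ y hy (character m)) =
      pullFunction f hη (Δ.torusElement m.1) := by
  rw [algebraMap_pullGerm hη, coneRingMap_zeroCone_character]

lemma map_torusElement_ne_zero {K : Type*} [CommRing K] [Nontrivial K]
    (φ : coneRing Δ.zeroCone.1 →+* K) (m : Module.Dual ℤ N) : φ (Δ.torusElement m) ≠ 0 := by
  intro h
  have h1 : φ (Δ.torusElement (m + -m)) = 0 := by rw [torusElement_add, map_mul, h, zero_mul]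
  rw [add_neg_cancel, torusElement_zero, map_one] at h1
  exact one_ne_zero h1

include hη in
lemma pullGerm_character_ne_zero {σ : Δ.Cone} {y : Y} (hy : f y ∈ Δ.chartOpens σ)
    (m : dualMonoid σ.1) : pullGerm f σ y hy (character m) ≠ 0 := by
  intro h
  have := algebraMap_pullGerm_character hη hy m
  rw [h, map_zero] at this
  exact map_torusElement_ne_zero _ _ this.symm

variable [IsLocallyNoetherian Y]

/-- The order of vanishing along a prime divisor, as a function of the character. -/
def ordHom (φ : coneRing Δ.zeroCone.1 →+* Y.functionField) (z : Y) : Module.Dual ℤ N →+ ℤ where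
  toFun m := Scheme.ord (φ (Δ.torusElement m)) z
  map_zero' := by
    have h := Scheme.ord_mul (x := z) (one_ne_zero (α := Y.functionField)) one_ne_zero
    rw [mul_one] at h
    rw [torusElement_zero, map_one]
    omega
  map_add' m m' := by
    rw [torusElement_add, map_mul, Scheme.ord_mul (map_torusElement_ne_zero _ _)
      (map_torusElement_ne_zero _ _)]

lemma ordHom_apply (φ : coneRing Δ.zeroCone.1 →+* Y.functionField) (z : Y)
    (m : Module.Dual ℤ N) : ordHom φ z m = Scheme.ord (φ (Δ.torusElement m)) z := rfl

variable (f) in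
/-- The effective divisors `D(ρ)` are the pull-backs of the divisors `V(ρ)`. -/
def IsPullback (D : Δ.Ray → EffectiveWeilDivisor Y) : Prop :=
  ∀ (ρ : Δ.Ray) (y : Y), Order.coheight y = 1 →
    pullbackMultiplicity f ρ.divisor y = ((D ρ).coeff y : ℕ∞)

omit [IsIntegral Y] [IsLocallyNoetherian Y] in
lemma IsPullback.coeff_eq_zero {D : Δ.Ray → EffectiveWeilDivisor Y} (hD : IsPullback f D)
    {ρ : Δ.Ray} {σ : Δ.Cone} (h : ¬ ρ.1 ≤ σ) {y : Y} (hy : f y ∈ Δ.chartOpens σ) :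
    (D ρ).coeff y = 0 := by
  by_contra h0
  have := hD ρ y ((D ρ).codim_one y h0)
  rw [pullbackMultiplicity_eq_zero f h hy] at this
  exact h0 (by exact_mod_cast this.symm)

/-- The divisor of the pull-back of a character. -/
lemma IsPullback.ord_eq {D : Δ.Ray → EffectiveWeilDivisor Y} (hD : IsPullback f D)
    (m : Module.Dual ℤ N) {z : Y} (hz : Order.coheight z = 1) :
    Scheme.ord (pullFunction f hη (Δ.torusElement m)) z =
      ∑ ρ, m ρ.generator * ((D ρ).coeff z : ℤ) := by
  classical
  obtain ⟨σ, hσ⟩ := exists_mem_chartOpens (f z)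
  rw [← ordHom_apply]
  have hex : ∀ ρ : Δ.Ray, ∃ u : Module.Dual ℤ N,
      ordHom (pullFunction f hη) z u = (D ρ).coeff z ∧
      ∀ ρ' : Δ.Ray, ρ'.1 ≤ σ → u ρ'.generator = if ρ' = ρ then 1 else 0 := by
    intro ρ
    by_cases hρ : ρ.1 ≤ σ
    · obtain ⟨u, hu, hu1, hu0⟩ := exists_dual_ray hρ
      have hne := pullGerm_character_ne_zero hη hσ ⟨u, hu⟩
      obtain ⟨n, hn1, hn2⟩ := exists_ord_eq hz hne
      rw [algebraMap_pullGerm_character hη] at hn2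
      rw [← pullbackMultiplicity_eq_ord f hρ (m := ⟨u, hu⟩) hu1 hu0 hσ, hD ρ z hz] at hn1
      refine ⟨u, ?_, fun ρ' hρ' => ?_⟩
      · rw [ordHom_apply, hn2]
        exact_mod_cast hn1.symm
      · split_ifs with h
        · rw [h, hu1]
        · exact hu0 ρ' hρ' h
    · refine ⟨0, by rw [map_zero, hD.coeff_eq_zero hρ hσ, Nat.cast_zero], fun ρ' hρ' => ?_⟩
      rw [if_neg (by rintro rfl; exact hρ hρ')]
      rfl
  choose u hu1 hu2 using hex
  -- `u ρ` is dual to `ρ` if `ρ` is a ray of `σ`, and `0` otherwise.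
  let v := m - ∑ ρ, m ρ.generator • u ρ
  have hv : ∀ ρ' : Δ.Ray, ρ'.1 ≤ σ → v ρ'.generator = 0 := by
    intro ρ' hρ'
    simp [v, LinearMap.sum_apply, hu2 _ ρ' hρ']
  -- `v` vanishes on `σ`, so `e(v)` is invertible on the chart `U_σ`.
  have hord : ordHom (pullFunction f hη) z v = 0 := by
    have h1 : v ∈ dualMonoid σ.1 :=
      (mem_dualMonoid_iff σ).2 fun ρ' hρ' => (hv ρ' hρ').ge
    have h2 : -v ∈ dualMonoid σ.1 :=
      (mem_dualMonoid_iff σ).2 fun ρ' hρ' => by rw [LinearMap.neg_apply, hv ρ' hρ', neg_zero]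
    have hunit : IsUnit (pullGerm f σ z hσ (character ⟨v, h1⟩)) := by
      refine IsUnit.map _ (IsUnit.of_mul_eq_one (character ⟨-v, h2⟩) ?_)
      rw [← character_add, ← character_zero]
      congr 1
      exact Subtype.ext (add_neg_cancel v)
    have := (isUnit_iff_ord_eq_zero hz (pullGerm_character_ne_zero hη hσ ⟨v, h1⟩)).1 hunit
    rwa [algebraMap_pullGerm_character hη] at this
  have hm : m = v + ∑ ρ, m ρ.generator • u ρ := (sub_add_cancel _ _).symm
  conv_lhs => rw [hm]
  rw [map_add, hord, zero_add, map_sum]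
  refine Finset.sum_congr rfl fun ρ _ => ?_
  rw [map_zsmul, hu1, smul_eq_mul]

include hη in
/-- The preimage of a chart is the complement of the divisors of the rays that are not in the
cone. -/
lemma IsPullback.mem_chartOpens_iff {D : Δ.Ray → EffectiveWeilDivisor Y} (hD : IsPullback f D)
    (σ : Δ.Cone) (y : Y) :
    f y ∈ Δ.chartOpens σ ↔ ∀ ρ : Δ.Ray, ¬ ρ.1 ≤ σ → y ∉ (D ρ).support := by
  have hmp : ∀ (σ : Δ.Cone) (y : Y), f y ∈ Δ.chartOpens σ →
      ∀ ρ : Δ.Ray, ¬ ρ.1 ≤ σ → y ∉ (D ρ).support := by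
    intro σ y hy ρ hρ hyρ
    rw [EffectiveWeilDivisor.support_eq] at hyρ
    obtain ⟨z, hz, hzy⟩ := hyρ
    exact hz (hD.coeff_eq_zero hρ
      ((hzy.map f.continuous).mem_open (Δ.chartOpens σ).isOpen hy))
  refine ⟨hmp σ y, fun h => ?_⟩
  obtain ⟨τ, hτ⟩ := exists_mem_chartOpens (f y)
  obtain ⟨m, hm, hU⟩ := exists_character_cutting (infCone_le_right σ τ)
  -- It remains to see that the character `e(m)` cutting out `U_σ ∩ U_τ` in `U_τ` is invertible at `y`,
  -- which can be tested on prime divisors through `y`.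
  refine chartOpens_mono (infCone_le_left σ τ) ((hU _ hτ).2 ?_)
  rw [← isUnit_pullGerm_iff]
  refine isUnit_of_forall_coheight_eq_one (pullGerm_character_ne_zero hη hτ m) ?_
  intro z hzy hz
  have hzτ : f z ∈ Δ.chartOpens τ :=
    (hzy.map f.continuous).mem_open (Δ.chartOpens τ).isOpen hτ
  rw [stalkSpecializes_pullGerm f le_rfl hzy hτ hzτ, coneRingMap_character,
    isUnit_iff_ord_eq_zero hz (pullGerm_character_ne_zero hη hzτ _),
    algebraMap_pullGerm_character hη, hD.ord_eq hη _ hz]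
  refine Finset.sum_eq_zero fun ρ _ => ?_
  by_cases hρ : ρ.1 ≤ τ
  · by_cases hρσ : ρ.1 ≤ σ
    · have : m.1 ρ.generator = 0 :=
        (hm ρ hρ).2 (show ρ.1.1 ≤ σ.1 ⊓ τ.1 from le_inf hρσ hρ)
      change m.1 ρ.generator * _ = 0
      rw [this, zero_mul]
    · have : (D ρ).coeff z = 0 := by
        by_contra h0
        refine h ρ hρσ ?_
        rw [EffectiveWeilDivisor.support_eq]
        exact ⟨z, h0, hzy⟩
      rw [this, Nat.cast_zero, mul_zero]
  · rw [hD.coeff_eq_zero hρ hzτ, Nat.cast_zero, mul_zero]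

end Pullback

end SmoothFan

/-! ### The pair attached to a morphism -/

/-- A proper closed subset of a Noetherian irreducible scheme contains only finitely many points of
codimension one: they are generic points of its irreducible components. -/
lemma finite_coheight_eq_one {Y : Scheme.{0}} [IsIntegral Y] [TopologicalSpace.NoetherianSpace Y]
    {C : Set Y} (hC : IsClosed C) (hη : genericPoint Y ∉ C) :
    {z | z ∈ C ∧ Order.coheight z = 1}.Finite := by
  obtain ⟨S, hS, hcl, hirr, hCS⟩ :=
    TopologicalSpace.NoetherianSpace.exists_finite_set_isClosed_irreducible hC
  have hgen : ∀ W : S, ∃ w, IsGenericPoint w W.1 := fun W =>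
    QuasiSober.sober (hirr W W.2) (hcl W W.2)
  choose w hw using hgen
  have : Finite S := hS
  refine (Set.finite_range w).subset ?_
  rintro z ⟨hz, hz1⟩
  rw [hCS] at hz
  obtain ⟨W, hW, hzW⟩ := hz
  refine ⟨⟨W, hW⟩, ?_⟩
  have hwz : w ⟨W, hW⟩ ⤳ z := (hw ⟨W, hW⟩).specializes hzW
  have hwC : w ⟨W, hW⟩ ∈ C := by
    rw [hCS]
    exact ⟨W, hW, (hw ⟨W, hW⟩).mem⟩
  by_contra hne
  have hle : z ≤ w ⟨W, hW⟩ := hwz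
  have hle' : w ⟨W, hW⟩ ≤ genericPoint Y := genericPoint_specializes _
  have hlt : z < w ⟨W, hW⟩ := lt_of_le_not_ge hle fun h : z ⤳ _ => hne (hwz.antisymm h).eq
  have hlt' : w ⟨W, hW⟩ < genericPoint Y := lt_of_le_not_ge hle' fun h : _ ⤳ genericPoint Y =>
    hη (((genericPoint_specializes _ : genericPoint Y ⤳ _).antisymm h).eq ▸ hwC)
  have h1 := Order.coheight_add_one_le hlt
  have h2 := Order.coheight_add_one_le hlt'
  rw [hz1] at h1
  have h3 : (1 : ℕ∞) ≤ Order.coheight (w ⟨W, hW⟩) := le_trans (by simp) h2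
  have h4 : (1 : ℕ∞) + 1 ≤ 1 := le_trans (by gcongr) h1
  exact absurd h4 (by decide)

namespace SmoothFan

variable {N : Type} [AddCommGroup N] {Δ : SmoothFan N}

variable (Δ) in
/-- The characters of the torus, as units of its coordinate ring. -/
def torusUnits : Multiplicative (Module.Dual ℤ N) →* (coneRing Δ.zeroCone.1)ˣ :=
  MonoidHom.toHomUnits
    { toFun := fun m => Δ.torusElement m.toAdd
      map_one' := torusElement_zero
      map_mul' := fun m m' => torusElement_add m.toAdd m'.toAdd }

section Pullback

variable {Y : Scheme.{0}} [IsIntegral Y] [IsLocallyNoetherian Y] {f : Y ⟶ Δ.toricVariety}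

/-- The pull-backs of the divisors `V(ρ)` exist: their components are among the finitely many prime
divisors in the complement of `f⁻¹(T)`, and their multiplicities are finite. -/
lemma exists_isPullback [TopologicalSpace.NoetherianSpace Y]
    (hη : f (genericPoint Y) ∈ Δ.torus) :
    ∃ D : Δ.Ray → EffectiveWeilDivisor Y, IsPullback f D := by
  classical
  have hfin : {z : Y | z ∈ (f ⁻¹ᵁ Δ.torus : Set Y)ᶜ ∧ Order.coheight z = 1}.Finite :=
    finite_coheight_eq_one (f ⁻¹ᵁ Δ.torus).isOpen.isClosed_compl fun h => h hη
  let c : Δ.Ray → Y → ℕ := fun ρ z =>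
    if Order.coheight z = 1 then (pullbackMultiplicity f ρ.divisor z).toNat else 0
  have hc : ∀ ρ, Function.support (c ρ) ⊆
      {z : Y | z ∈ (f ⁻¹ᵁ Δ.torus : Set Y)ᶜ ∧ Order.coheight z = 1} := by
    intro ρ z hz
    simp only [Function.mem_support, c] at hz
    split_ifs at hz with h
    · refine ⟨fun hT => hz ?_, h⟩
      rw [pullbackMultiplicity_eq_zero f ρ.not_le_zeroCone hT]
      rfl
    · exact absurd rfl hz
  refine ⟨fun ρ => ⟨⟨c ρ, Set.subset_univ _, fun z _ => ⟨Set.univ, Filter.univ_mem,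
    (hfin.subset (hc ρ)).subset Set.inter_subset_right⟩⟩, fun z hz => (hc ρ hz).2⟩, ?_⟩
  intro ρ z hz
  change _ = ((c ρ z : ℕ) : ℕ∞)
  simp only [c, if_pos hz]
  symm
  refine ENat.natCast_toNat ?_
  obtain ⟨σ, hσ⟩ := exists_mem_chartOpens (f z)
  by_cases hρ : ρ.1 ≤ σ
  · obtain ⟨u, hu, hu1, hu0⟩ := exists_dual_ray hρ
    rw [pullbackMultiplicity_eq_ord f hρ (m := ⟨u, hu⟩) hu1 hu0 hσ]
    obtain ⟨n, hn, -⟩ := exists_ord_eq hz (pullGerm_character_ne_zero hη hσ ⟨u, hu⟩)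
    rw [hn]
    exact ENat.natCast_ne_top n
  · rw [pullbackMultiplicity_eq_zero f hρ hσ]
    exact ENat.zero_ne_top

lemma IsPullback.complement_eq {D : Δ.Ray → EffectiveWeilDivisor Y} (hD : IsPullback f D)
    (hη : f (genericPoint Y) ∈ Δ.torus) : complement D = f ⁻¹ᵁ Δ.torus := by
  ext y
  change y ∈ (⋃ i, (D i).support)ᶜ ↔ f y ∈ Δ.chartOpens Δ.zeroCone
  rw [hD.mem_chartOpens_iff hη]
  simp only [Set.mem_compl_iff, Set.mem_iUnion, not_exists]
  exact ⟨fun h ρ _ => h ρ, fun h ρ => h ρ ρ.not_le_zeroCone⟩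

lemma IsPullback.inter_eq_empty {D : Δ.Ray → EffectiveWeilDivisor Y} (hD : IsPullback f D)
    (hη : f (genericPoint Y) ∈ Δ.torus) (s : Finset Δ.Ray) (hs : (⨆ ρ ∈ s, ρ.1.1) ∉ Δ.cones) :
    ⋂ ρ ∈ s, (D ρ).support = ∅ := by
  rw [Set.eq_empty_iff_forall_notMem]
  intro y hy
  rw [Set.mem_iInter₂] at hy
  obtain ⟨σ, hσ⟩ := exists_mem_chartOpens (f y)
  refine hs (iSup_rays_mem (σ := σ) s fun ρ hρ => ?_)
  by_contra h
  exact (hD.mem_chartOpens_iff hη σ y).1 hσ ρ h (hy ρ hρ)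

end Pullback

variable {Y : NormalVariety} {f : Y.scheme ⟶ Δ.toricVariety}

instance (Y : NormalVariety) : TopologicalSpace.NoetherianSpace Y.scheme := by
  have : CompactSpace Y.scheme := QuasiCompact.compactSpace_of_compactSpace Y.toSpec
  have : IsNoetherian Y.scheme := {}
  infer_instance

/-- The pull-back of functions on the torus to the complement of the divisors `D(ρ)`. -/
def pullComplement (D : Δ.Ray → EffectiveWeilDivisor Y.scheme)
    (h : complement D = f ⁻¹ᵁ Δ.torus) :
    coneRing Δ.zeroCone.1 →+* Γ(Y.scheme, complement D) :=
  (Y.scheme.presheaf.map (eqToHom h).op).hom.comp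
    ((f.app Δ.torus).hom.comp (Δ.chartFunction Δ.zeroCone))

lemma germToFunctionField_pullComplement (hη : f (genericPoint Y.scheme) ∈ Δ.torus)
    (D : Δ.Ray → EffectiveWeilDivisor Y.scheme)
    (h : complement D = f ⁻¹ᵁ Δ.torus) (a : coneRing Δ.zeroCone.1) :
    Y.scheme.germToFunctionField (complement D) (pullComplement D h a) = pullFunction f hη a := by
  change Y.scheme.presheaf.germ _ _ _ (Y.scheme.presheaf.map (eqToHom h).op _) = _
  rw [TopCat.Presheaf.germ_res_apply]
  exact germ_app_chartFunction f Δ.zeroCone (genericPoint Y.scheme) hη a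

/-- Every morphism meeting the torus has an attached pair. -/
lemma exists_isAttached (hη : f (genericPoint Y.scheme) ∈ Δ.torus) :
    ∃ P : DivisorData Δ Y, IsAttached f P := by
  obtain ⟨D, hD⟩ := exists_isPullback hη
  have h := hD.complement_eq hη
  refine ⟨⟨D, hD.inter_eq_empty hη, (Units.map (pullComplement D h).toMonoidHom).comp Δ.torusUnits,
    fun m y hy => ?_⟩, hD, h, fun m => rfl⟩
  rw [← hD.ord_eq hη m hy, ← germToFunctionField_pullComplement hη D h]
  rfl

end SmoothFan

/-! ### Morphisms to the toric variety from functions -/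

/-- Morphisms on the members of an open cover that agree on the pairwise intersections glue. -/
lemma exists_glued_hom {X Y : Scheme.{0}} {ι : Type} (V : ι → Y.Opens)
    (hV : ∀ y, ∃ i, y ∈ V i) (g : ∀ i, (V i).toScheme ⟶ X)
    (hg : ∀ i j, Y.homOfLE (inf_le_left : V i ⊓ V j ≤ V i) ≫ g i =
      Y.homOfLE (inf_le_right : V i ⊓ V j ≤ V j) ≫ g j) :
    ∃ f : Y ⟶ X, ∀ i, (V i).ι ≫ f = g i := by
  have hc : TopologicalSpace.IsOpenCover V := by
    refine top_le_iff.1 fun y _ => ?_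
    obtain ⟨i, hi⟩ := hV y
    exact TopologicalSpace.Opens.mem_iSup.2 ⟨i, hi⟩
  refine ⟨(Y.openCoverOfIsOpenCover V hc).glueMorphisms g fun i j => ?_,
    fun i => (Y.openCoverOfIsOpenCover V hc).ι_glueMorphisms _ _ i⟩
  change pullback.fst (V i).ι (V j).ι ≫ g i = pullback.snd (V i).ι (V j).ι ≫ g j
  let p : pullback (V i).ι (V j).ι ⟶ Y := pullback.fst (V i).ι (V j).ι ≫ (V i).ι
  have hp : p = pullback.snd (V i).ι (V j).ι ≫ (V j).ι := pullback.condition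
  have hr : Set.range p ⊆ Set.range (V i ⊓ V j).ι := by
    rw [Scheme.Opens.range_ι]
    rintro _ ⟨x, rfl⟩
    refine ⟨(pullback.fst (V i).ι (V j).ι x).2, ?_⟩
    rw [hp]
    exact (pullback.snd (V i).ι (V j).ι x).2
  let q := IsOpenImmersion.lift (V i ⊓ V j).ι p hr
  have hq : q ≫ (V i ⊓ V j).ι = p := IsOpenImmersion.lift_fac _ _ _
  have h1 : pullback.fst (V i).ι (V j).ι = q ≫ Y.homOfLE inf_le_left := by
    rw [← cancel_mono (V i).ι, Category.assoc, Scheme.homOfLE_ι, hq]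
  have h2 : pullback.snd (V i).ι (V j).ι = q ≫ Y.homOfLE inf_le_right := by
    rw [← cancel_mono (V j).ι, Category.assoc, Scheme.homOfLE_ι, hq, hp]
  rw [h1, h2, Category.assoc, Category.assoc]
  exact congrArg (q ≫ ·) (hg i j)

section Sections

variable {X Y : Scheme.{0}} {U : X.Opens} (hU : IsAffineOpen U) {V : Y.Opens}

/-- The morphism `V → U ⊆ X` to an affine open given by a homomorphism of rings of functions. -/
def homOfSections (θ : Γ(X, U) ⟶ Γ(Y, V)) : V.toScheme ⟶ X :=
  V.toSpecΓ ≫ Spec.map θ ≫ hU.fromSpec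

lemma ι_comp_eq_homOfSections (f : Y ⟶ X) (h : V ≤ f ⁻¹ᵁ U) :
    V.ι ≫ f = homOfSections hU (f.appLE U V h) := by
  rw [homOfSections, Scheme.Opens.toSpecΓ_SpecMap_appLE_assoc, hU.toSpecΓ_fromSpec,
    Scheme.Hom.resLE_comp_ι]

lemma homOfLE_homOfSections {W : Y.Opens} (h : W ≤ V) (θ : Γ(X, U) ⟶ Γ(Y, V)) :
    Y.homOfLE h ≫ homOfSections hU θ =
      homOfSections hU (θ ≫ Y.presheaf.map (homOfLE h).op) := by
  rw [homOfSections, homOfSections, Spec.map_comp, Category.assoc,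
    Scheme.Opens.toSpecΓ_SpecMap_presheaf_map_assoc]

lemma homOfSections_map {U' : X.Opens} (hU' : IsAffineOpen U') (h : U' ≤ U)
    (θ : Γ(X, U') ⟶ Γ(Y, V)) :
    homOfSections hU (X.presheaf.map (homOfLE h).op ≫ θ) = homOfSections hU' θ := by
  rw [homOfSections, homOfSections, Spec.map_comp, Category.assoc,
    IsAffineOpen.map_fromSpec]

lemma le_preimage_of_ι_comp_eq {f : Y ⟶ X} {θ : Γ(X, U) ⟶ Γ(Y, V)}
    (h : V.ι ≫ f = homOfSections hU θ) : V ≤ f ⁻¹ᵁ U := by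
  intro y hy
  have h1 : f y = homOfSections hU θ ⟨y, hy⟩ := by rw [← h]; rfl
  change f y ∈ U
  rw [h1, ← SetLike.mem_coe, ← hU.range_fromSpec]
  exact ⟨_, rfl⟩

lemma appLE_eq_of_ι_comp_eq {f : Y ⟶ X} {θ : Γ(X, U) ⟶ Γ(Y, V)}
    (h : V.ι ≫ f = homOfSections hU θ) :
    f.appLE U V (le_preimage_of_ι_comp_eq hU h) = θ := by
  have h1 := ι_comp_eq_homOfSections hU f (le_preimage_of_ι_comp_eq hU h)
  rw [h, homOfSections, homOfSections, ← Category.assoc, ← Category.assoc,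
    cancel_mono] at h1
  have h2 := congrArg Scheme.Hom.appTop h1
  rw [Scheme.Hom.comp_appTop, Scheme.Hom.comp_appTop, Scheme.Opens.toSpecΓ_appTop,
    ← Category.assoc, ← Category.assoc, cancel_mono, Scheme.ΓSpecIso_naturality,
    Scheme.ΓSpecIso_naturality, cancel_epi] at h2
  exact h2.symm

end Sections

section Constants

variable {X Y : Scheme.{0}}

lemma le_preimage_top (s : X ⟶ Y) (U : X.Opens) : U ≤ s ⁻¹ᵁ ⊤ := le_top

/-- The constant functions on an open subset of a scheme over `ℂ`. -/
def constSection (s : X ⟶ Spec (.of ℂ)) (U : X.Opens) : ℂ →+* Γ(X, U) :=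
  ((Scheme.ΓSpecIso (.of ℂ)).inv ≫ s.appLE ⊤ U (le_preimage_top s U)).hom

lemma map_constSection (s : X ⟶ Spec (.of ℂ)) {U V : X.Opens} (h : V ≤ U) (c : ℂ) :
    X.presheaf.map (homOfLE h).op (constSection s U c) = constSection s V c := by
  change (s.appLE ⊤ U _ ≫ X.presheaf.map (homOfLE h).op) ((Scheme.ΓSpecIso (.of ℂ)).inv c) = _
  rw [Scheme.Hom.appLE_map]
  rfl

lemma appLE_constSection (f : Y ⟶ X) (s : X ⟶ Spec (.of ℂ)) {U : X.Opens} {V : Y.Opens}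
    (h : V ≤ f ⁻¹ᵁ U) (c : ℂ) :
    f.appLE U V h (constSection s U c) = constSection (f ≫ s) V c := by
  change (s.appLE ⊤ U _ ≫ f.appLE U V h) ((Scheme.ΓSpecIso (.of ℂ)).inv c) = _
  rw [Scheme.Hom.appLE_comp_appLE]
  rfl

lemma constSection_top (s : X ⟶ Spec (.of ℂ)) (c : ℂ) :
    constSection s ⊤ c = ((Scheme.ΓSpecIso (.of ℂ)).inv ≫ s.appTop) c := by
  have h : s.appLE ⊤ ⊤ (le_preimage_top s ⊤) = s.appTop := Scheme.Hom.appLE_eq_app s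
  rw [← h]
  rfl

lemma eq_of_constSection_eq {s t : X ⟶ Spec (.of ℂ)}
    (h : ∀ c, constSection s ⊤ c = constSection t ⊤ c) : s = t := by
  refine ext_of_isAffine ?_
  rw [← cancel_epi (Scheme.ΓSpecIso (.of ℂ)).inv]
  ext c
  exact ((constSection_top s c).symm.trans (h c)).trans (constSection_top t c)

instance [IsIntegral X] : Nonempty (⊤ : X.Opens) := ⟨⟨genericPoint X, trivial⟩⟩

/-- The constants, as elements of the function field. -/
def constFunction [IsIntegral X] (s : X ⟶ Spec (.of ℂ)) : ℂ →+* X.functionField :=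
  (X.germToFunctionField ⊤).hom.comp (constSection s ⊤)

lemma germToFunctionField_constSection [IsIntegral X] (s : X ⟶ Spec (.of ℂ)) (U : X.Opens)
    [hU : Nonempty U] (c : ℂ) :
    X.germToFunctionField U (constSection s U c) = constFunction s c := by
  rw [← map_constSection s (le_top : U ≤ ⊤)]
  exact TopCat.Presheaf.germ_res_apply _ _ _ _ _

end Constants

lemma coneRingMap_coneRingMap {N : Type} [AddCommGroup N] {ρ τ σ : PointedCone ℝ (ℝ ⊗[ℤ] N)}
    (h : ρ ≤ τ) (h' : τ ≤ σ) (a : coneRing σ) :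
    coneRingMap h (coneRingMap h' a) = coneRingMap (h.trans h') a := by
  induction a using AddMonoidAlgebra.induction_linear with
  | zero => simp
  | add a b ha hb => rw [map_add, map_add, map_add, ha, hb]
  | single m c =>
    rw [coneRingMap_single, coneRingMap_single, coneRingMap_single]
    rfl

lemma coneRingMap_refl {N : Type} [AddCommGroup N] {σ : PointedCone ℝ (ℝ ⊗[ℤ] N)}
    (h : σ ≤ σ) (a : coneRing σ) : coneRingMap h a = a := by
  apply coneRingMap_injective h
  rw [coneRingMap_coneRingMap]

namespace SmoothFan

variable {N : Type} [AddCommGroup N] {Δ : SmoothFan N}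

lemma chart_toSpec (σ : Δ.Cone) : Δ.chart σ ≫ Δ.toSpec =
    Spec.map (CommRingCat.ofHom (algebraMap ℂ (coneRing σ.1))) :=
  colimit.ι_desc _ _

lemma chartFunction_algebraMap (σ : Δ.Cone) (c : ℂ) :
    Δ.chartFunction σ (algebraMap ℂ _ c) = constSection Δ.toSpec (Δ.chartOpens σ) c := by
  have hinj : Function.Injective ((Δ.chart σ).appLE (Δ.chartOpens σ) ⊤
      ((Δ.chart σ).preimage_image_eq ⊤).ge) := by
    intro a b hab
    obtain ⟨a, rfl⟩ := (chartFunction_bijective Δ σ).2 a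
    obtain ⟨b, rfl⟩ := (chartFunction_bijective Δ σ).2 b
    rw [appLE_chartFunction, appLE_chartFunction] at hab
    rw [(ConcreteCategory.bijective_of_isIso
      (Scheme.ΓSpecIso (.of (coneRing σ.1))).inv).1 hab]
  apply hinj
  rw [appLE_chartFunction, appLE_constSection, chart_toSpec]
  have h := ConcreteCategory.congr_hom (Scheme.ΓSpecIso_inv_naturality
    (CommRingCat.ofHom (algebraMap ℂ (coneRing σ.1)))) c
  exact h.trans (constSection_top _ c).symm

section Functions

variable {Y : Scheme.{0}} [IsIntegral Y] {f : Y ⟶ Δ.toricVariety}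

lemma germToFunctionField_appLE (hη : f (genericPoint Y) ∈ Δ.torus) {σ : Δ.Cone} {V : Y.Opens}
    [hV : Nonempty V] (h : V ≤ f ⁻¹ᵁ Δ.chartOpens σ) (a : coneRing σ.1) :
    Y.germToFunctionField V (f.appLE (Δ.chartOpens σ) V h (Δ.chartFunction σ a)) =
      pullFunction f hη (coneRingMap (zeroCone_le σ) a) := by
  have hy : f (genericPoint Y) ∈ Δ.chartOpens σ := chartOpens_mono (zeroCone_le σ) hη
  rw [← algebraMap_pullGerm hη σ (genericPoint Y) hy, ← germ_app_chartFunction]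
  change Y.presheaf.germ V _ _ (Y.presheaf.map (homOfLE h).op _) = _
  rw [TopCat.Presheaf.germ_res_apply]
  exact (TopCat.Presheaf.germ_stalkSpecializes_apply _ _ _ _).symm

/-- Morphisms that map the same open sets into the charts, and agree on functions, are equal. -/
lemma hom_eq_of_pullFunction_eq {g : Y ⟶ Δ.toricVariety} (hf : f (genericPoint Y) ∈ Δ.torus)
    (hg : g (genericPoint Y) ∈ Δ.torus)
    (hV : ∀ σ : Δ.Cone, f ⁻¹ᵁ Δ.chartOpens σ = g ⁻¹ᵁ Δ.chartOpens σ)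
    (h : pullFunction f hf = pullFunction g hg) : f = g := by
  refine Scheme.hom_ext_of_forall f g fun y => ?_
  obtain ⟨σ, hσ⟩ := exists_mem_chartOpens (f y)
  refine ⟨f ⁻¹ᵁ Δ.chartOpens σ, hσ, ?_⟩
  have : Nonempty (f ⁻¹ᵁ Δ.chartOpens σ) := ⟨⟨y, hσ⟩⟩
  rw [ι_comp_eq_homOfSections (isAffineOpen_chartOpens σ) f le_rfl,
    ι_comp_eq_homOfSections (isAffineOpen_chartOpens σ) g (hV σ).le]
  congr 1
  ext s
  obtain ⟨a, rfl⟩ := (chartFunction_bijective Δ σ).2 s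
  apply Scheme.germToFunctionField_injective Y (f ⁻¹ᵁ Δ.chartOpens σ)
  rw [germToFunctionField_appLE hf, germToFunctionField_appLE hg, h]

/-- A homomorphism from `ℂ[M]` to the function field of `Y` that maps the functions on `U_σ` to
functions regular on `V σ` comes from a morphism mapping `V σ` to `U_σ`. -/
lemma exists_hom_of_functions (φ : coneRing Δ.zeroCone.1 →+* Y.functionField)
    (V : Δ.Cone → Y.Opens) (hη : ∀ σ, genericPoint Y ∈ V σ) (hV : ∀ y, ∃ σ, y ∈ V σ)
    (hinf : ∀ σ τ, V σ ⊓ V τ ≤ V (infCone σ τ))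
    (hφ : ∀ σ, ∀ y ∈ V σ, ∀ a, φ (coneRingMap (zeroCone_le σ) a) ∈
      Set.range (algebraMap (Y.presheaf.stalk y) Y.functionField)) :
    ∃ f : Y ⟶ Δ.toricVariety, (∀ σ, V σ ≤ f ⁻¹ᵁ Δ.chartOpens σ) ∧
      ∀ hf : f (genericPoint Y) ∈ Δ.torus, pullFunction f hf = φ := by
  have hne : ∀ σ, Nonempty (V σ) := fun σ => ⟨⟨_, hη σ⟩⟩
  have hθ : ∀ σ, ∃ θ : Γ(Δ.toricVariety, Δ.chartOpens σ) ⟶ Γ(Y, V σ), ∀ a,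
      Y.germToFunctionField (V σ) (θ (Δ.chartFunction σ a)) =
        φ (coneRingMap (zeroCone_le σ) a) := by
    intro σ
    let e := RingEquiv.ofBijective _ (chartFunction_bijective Δ σ)
    let ι := (Y.germToFunctionField (V σ)).hom
    have hι : Function.Injective ι := Scheme.germToFunctionField_injective Y (V σ)
    let ψ : coneRing σ.1 →+* ι.range := (φ.comp (coneRingMap (zeroCone_le σ))).codRestrict _
      fun a => exists_section_of_forall_mem_range (V σ) fun y hy => hφ σ y hy a
    let r : Γ(Y, V σ) ≃+* ι.range := RingEquiv.ofBijective ι.rangeRestrict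
      ⟨fun a b h => hι (congrArg Subtype.val h), ι.rangeRestrict_surjective⟩
    refine ⟨CommRingCat.ofHom ((r.symm.toRingHom.comp ψ).comp e.symm.toRingHom), fun a => ?_⟩
    change (r (r.symm (ψ (e.symm (e a))))).1 = _
    rw [r.apply_symm_apply, e.symm_apply_apply]
    rfl
  choose θ hθ using hθ
  obtain ⟨f, hf⟩ := exists_glued_hom V hV
    (fun σ => homOfSections (isAffineOpen_chartOpens σ) (θ σ)) <| by
      intro σ τ
      have : Nonempty (V σ ⊓ V τ : Y.Opens) := ⟨⟨_, hη σ, hη τ⟩⟩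
      have key : ∀ (κ : Δ.Cone) (hκ : infCone σ τ ≤ κ) (h : V σ ⊓ V τ ≤ V κ),
          Y.homOfLE h ≫ homOfSections (isAffineOpen_chartOpens κ) (θ κ) =
            homOfSections (isAffineOpen_chartOpens (infCone σ τ))
              (θ (infCone σ τ) ≫ Y.presheaf.map (homOfLE (hinf σ τ)).op) := by
        intro κ hκ h
        rw [homOfLE_homOfSections,
          ← homOfSections_map (isAffineOpen_chartOpens κ) _ (chartOpens_mono hκ)]
        congr 1
        ext s
        obtain ⟨a, rfl⟩ := (chartFunction_bijective Δ κ).2 s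
        apply Scheme.germToFunctionField_injective Y (V σ ⊓ V τ)
        simp only [ConcreteCategory.comp_apply]
        rw [map_chartFunction]
        trans φ (coneRingMap (zeroCone_le κ) a)
        · rw [← hθ]
          exact TopCat.Presheaf.germ_res_apply _ _ _ _ _
        · trans Y.germToFunctionField _
            (θ (infCone σ τ) (Δ.chartFunction (infCone σ τ) (coneRingMap hκ a)))
          · rw [hθ]
            exact congrArg φ (coneRingMap_coneRingMap _ _ a).symm
          · exact (TopCat.Presheaf.germ_res_apply _ _ _ _ _).symm
      rw [key σ (infCone_le_left σ τ), key τ (infCone_le_right σ τ)]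
  have hle := fun σ => le_preimage_of_ι_comp_eq _ (hf σ)
  refine ⟨f, hle, fun hf' => RingHom.ext fun a => ?_⟩
  have h1 := germToFunctionField_appLE hf' (hle Δ.zeroCone) a
  rw [appLE_eq_of_ι_comp_eq _ (hf Δ.zeroCone), hθ, coneRingMap_refl] at h1
  exact h1.symm

end Functions

end SmoothFan

/-! ### The morphism of a pair, uniqueness, and the base point -/

open SmoothFan

variable {N : Type} [AddCommGroup N] {Δ : SmoothFan N}

section TorusRing

/-- A homomorphism from `ℂ[M]` is determined by its values on constants and characters. -/
lemma torusRing_hom_ext {K : Type*} [CommRing K] {φ ψ : coneRing Δ.zeroCone.1 →+* K}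
    (h1 : ∀ c : ℂ, φ (algebraMap ℂ _ c) = ψ (algebraMap ℂ _ c))
    (h2 : ∀ m, φ (Δ.torusElement m) = ψ (Δ.torusElement m)) : φ = ψ :=
  AddMonoidAlgebra.ringHom_ext h1 fun m => h2 m.1

lemma single_eq_algebraMap_mul (m : dualMonoid Δ.zeroCone.1) (c : ℂ) :
    (AddMonoidAlgebra.single m c : coneRing Δ.zeroCone.1) =
      algebraMap ℂ _ c * Δ.torusElement m.1 := by
  change _ = AddMonoidAlgebra.single 0 c * AddMonoidAlgebra.single m 1
  rw [AddMonoidAlgebra.single_mul_single, zero_add, mul_one]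

lemma augmentation_algebraMap (c : ℂ) : Δ.augmentation (algebraMap ℂ _ c) = c :=
  (AddMonoidAlgebra.lift ℂ ℂ (dualMonoid Δ.zeroCone.1) 1).commutes c

lemma augmentation_torusElement (m : Module.Dual ℤ N) : Δ.augmentation (Δ.torusElement m) = 1 := by
  change AddMonoidAlgebra.lift ℂ ℂ (dualMonoid Δ.zeroCone.1) 1 (AddMonoidAlgebra.single _ 1) = 1
  simp

end TorusRing

section Constants

variable {Y : Scheme.{0}} [IsIntegral Y] {f : Y ⟶ Δ.toricVariety}

lemma constFunction_mem_range (s : Y ⟶ Spec (.of ℂ)) (y : Y) (c : ℂ) :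
    constFunction s c ∈ Set.range (algebraMap (Y.presheaf.stalk y) Y.functionField) :=
  ⟨Y.presheaf.germ ⊤ y trivial (constSection s ⊤ c),
    TopCat.Presheaf.germ_stalkSpecializes_apply Y.presheaf (U := ⊤) trivial
      (genericPoint_specializes y) (constSection s ⊤ c)⟩

lemma pullFunction_algebraMap (hη : f (genericPoint Y) ∈ Δ.torus) (c : ℂ) :
    pullFunction f hη (algebraMap ℂ _ c) = constFunction (f ≫ Δ.toSpec) c := by
  have : Nonempty (f ⁻¹ᵁ Δ.chartOpens Δ.zeroCone) := ⟨⟨_, hη⟩⟩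
  have h := germToFunctionField_appLE hη (le_refl (f ⁻¹ᵁ Δ.chartOpens Δ.zeroCone))
    (algebraMap ℂ _ c)
  rw [chartFunction_algebraMap, appLE_constSection, germToFunctionField_constSection,
    coneRingMap_refl] at h
  exact h.symm

lemma constFunction_injective {s t : Y ⟶ Spec (.of ℂ)} (h : constFunction s = constFunction t) :
    s = t :=
  eq_of_constSection_eq fun c => Scheme.germToFunctionField_injective Y ⊤ (RingHom.congr_fun h c)

end Constants

section RegularLocus

variable {Y : Scheme.{0}}

/-- The complement of the divisors `D(ρ)` of the rays `ρ` that are not in the cone `σ`. -/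
def regularLocus (D : Δ.Ray → EffectiveWeilDivisor Y) (σ : Δ.Cone) : Y.Opens :=
  ⟨(⋃ ρ : {ρ : Δ.Ray // ¬ ρ.1 ≤ σ}, (D ρ).support)ᶜ,
    (isClosed_iUnion_of_finite fun _ => isClosed_closure).isOpen_compl⟩

lemma mem_regularLocus {D : Δ.Ray → EffectiveWeilDivisor Y} {σ : Δ.Cone} {y : Y} :
    y ∈ regularLocus D σ ↔ ∀ ρ : Δ.Ray, ¬ ρ.1 ≤ σ → y ∉ (D ρ).support := by
  change y ∈ (⋃ ρ : {ρ : Δ.Ray // ¬ ρ.1 ≤ σ}, (D ρ).support)ᶜ ↔ _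
  simp

lemma mem_complement {D : Δ.Ray → EffectiveWeilDivisor Y} {y : Y} :
    y ∈ complement D ↔ ∀ ρ : Δ.Ray, y ∉ (D ρ).support := by
  change y ∈ (⋃ ρ, (D ρ).support)ᶜ ↔ _
  simp

lemma regularLocus_inf_le (D : Δ.Ray → EffectiveWeilDivisor Y) (σ τ : Δ.Cone) :
    regularLocus D σ ⊓ regularLocus D τ ≤ regularLocus D (infCone σ τ) := by
  rintro y ⟨h1, h2⟩
  refine mem_regularLocus.2 fun ρ hρ => ?_
  by_cases h : ρ.1 ≤ σ
  · exact mem_regularLocus.1 h2 ρ fun h' =>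
      hρ (show ρ.1.1 ≤ σ.1 ⊓ τ.1 from le_inf h h')
  · exact mem_regularLocus.1 h1 ρ h

lemma EffectiveWeilDivisor.coeff_eq_zero_of_specializes {D : EffectiveWeilDivisor Y} {z y : Y}
    (h : z ⤳ y) (hy : y ∉ D.support) : D.coeff z = 0 := by
  by_contra h0
  refine hy ?_
  rw [EffectiveWeilDivisor.support_eq]
  exact ⟨z, h0, h⟩

end RegularLocus

namespace DivisorData

variable {Y : NormalVariety} (P : DivisorData Δ Y)

/-- The germs of the functions `ε(m)` at the generic point. -/
def germHom : Multiplicative (Module.Dual ℤ N) →* Y.scheme.functionField :=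
  (Y.scheme.germToFunctionField (complement P.D)).hom.toMonoidHom.comp
    ((Units.coeHom _).comp P.ε)

/-- The homomorphism from `ℂ[M]` to the function field of `Y` with `e(m) ↦ ε(m)`. -/
def functionHom : coneRing Δ.zeroCone.1 →+* Y.scheme.functionField :=
  AddMonoidAlgebra.liftNCRingHom (constFunction Y.toSpec)
    (P.germHom.comp (AddMonoidHom.toMultiplicative (dualMonoid Δ.zeroCone.1).subtype))
    fun _ _ => Commute.all _ _

lemma functionHom_torusElement (m : Module.Dual ℤ N) :
    P.functionHom (Δ.torusElement m) = P.germHom (Multiplicative.ofAdd m) := by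
  refine (AddMonoidAlgebra.liftNCRingHom_single _ _ _ _ _).trans ?_
  rw [map_one, one_mul]
  rfl

lemma functionHom_algebraMap (c : ℂ) :
    P.functionHom (algebraMap ℂ _ c) = constFunction Y.toSpec c := by
  refine (AddMonoidAlgebra.liftNCRingHom_single _ _ _ _ _).trans ?_
  rw [ofAdd_zero, map_one, mul_one]
  rfl

lemma ord_functionHom (m : Module.Dual ℤ N) {z : Y.scheme} (hz : Order.coheight z = 1) :
    Scheme.ord (P.functionHom (Δ.torusElement m)) z =
      ∑ ρ, m ρ.generator * ((P.D ρ).coeff z : ℤ) := by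
  rw [functionHom_torusElement]
  exact P.div_eq m z hz

/-- By normality, `ε(m)` for `m` nonnegative on `σ` is regular where no `D(ρ)` with `ρ` outside `σ`
passes. -/
lemma functionHom_mem_range {σ : Δ.Cone} {y : Y.scheme} (hy : y ∈ regularLocus P.D σ)
    (a : coneRing σ.1) : P.functionHom (coneRingMap (zeroCone_le σ) a) ∈
      Set.range (algebraMap (Y.scheme.presheaf.stalk y) Y.scheme.functionField) := by
  change _ ∈ (algebraMap (Y.scheme.presheaf.stalk y) Y.scheme.functionField).range
  induction a using AddMonoidAlgebra.induction_linear with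
  | zero => rw [map_zero, map_zero]; exact zero_mem _
  | add a b ha hb => rw [map_add, map_add]; exact add_mem ha hb
  | single m c =>
    rw [coneRingMap_single, single_eq_algebraMap_mul, map_mul, functionHom_algebraMap]
    refine mul_mem (constFunction_mem_range _ _ _) ?_
    have := Y.normal
    refine mem_range_of_forall_coheight_eq_one fun z hzy hz => mem_range_of_ord_nonneg hz ?_
    rw [P.ord_functionHom _ hz]
    refine Finset.sum_nonneg fun ρ _ => ?_
    by_cases hρ : ρ.1 ≤ σ
    · exact mul_nonneg ((mem_dualMonoid_iff σ).1 m.2 ρ hρ) (Nat.cast_nonneg _)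
    · rw [EffectiveWeilDivisor.coeff_eq_zero_of_specializes hzy (mem_regularLocus.1 hy ρ hρ),
        Nat.cast_zero, mul_zero]

/-- The condition on intersections says that the open sets `regularLocus P.D σ` cover `Y`: the rays
whose divisors pass through `y` span a cone of the fan. -/
lemma exists_mem_regularLocus (y : Y.scheme) : ∃ σ, y ∈ regularLocus P.D σ := by
  classical
  let s : Finset Δ.Ray := Finset.univ.filter fun ρ => y ∈ (P.D ρ).support
  have hs : (⨆ ρ ∈ s, ρ.1.1) ∈ Δ.cones := by
    by_contra h
    have h1 := P.inter_eq_empty s h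
    rw [Set.eq_empty_iff_forall_notMem] at h1
    exact h1 y (Set.mem_iInter₂.2 fun ρ hρ => (Finset.mem_filter.1 hρ).2)
  refine ⟨⟨_, hs⟩, mem_regularLocus.2 fun ρ hρ hy => hρ ?_⟩
  exact le_iSup₂_of_le (f := fun (ρ : Δ.Ray) (_ : ρ ∈ s) => ρ.1.1) ρ
    (Finset.mem_filter.2 ⟨Finset.mem_univ _, hy⟩) le_rfl

lemma genericPoint_mem_regularLocus (σ : Δ.Cone) : genericPoint Y.scheme ∈ regularLocus P.D σ :=
  mem_regularLocus.2 fun ρ _ => mem_complement.1 (genericPoint_mem_complement P.D) ρ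

/-- If `f` maps each `regularLocus P.D σ` to `U_σ` and pulls back `e(m)` to `ε(m)`, then the
divisors `D(ρ)` are the pull-backs of the `V(ρ)`. -/
lemma isPullback_of_pullFunction_eq {f : Y.scheme ⟶ Δ.toricVariety}
    (hV : ∀ σ, regularLocus P.D σ ≤ f ⁻¹ᵁ Δ.chartOpens σ)
    (hη : f (genericPoint Y.scheme) ∈ Δ.torus) (hf : pullFunction f hη = P.functionHom) :
    IsPullback f P.D := by
  intro ρ y hy
  obtain ⟨σ, hσ⟩ := P.exists_mem_regularLocus y
  have hyσ : f y ∈ Δ.chartOpens σ := hV σ hσ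
  have h0 : ∀ ρ' : Δ.Ray, ¬ ρ'.1 ≤ σ → (P.D ρ').coeff y = 0 := fun ρ' h =>
    EffectiveWeilDivisor.coeff_eq_zero_of_specializes specializes_rfl (mem_regularLocus.1 hσ ρ' h)
  by_cases hρ : ρ.1 ≤ σ
  · obtain ⟨u, hu, hu1, hu0⟩ := exists_dual_ray hρ
    obtain ⟨n, hn1, hn2⟩ := exists_ord_eq hy (pullGerm_character_ne_zero hη hyσ ⟨u, hu⟩)
    rw [pullbackMultiplicity_eq_ord f hρ (m := ⟨u, hu⟩) hu1 hu0 hyσ, hn1]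
    rw [algebraMap_pullGerm_character hη, hf, P.ord_functionHom _ hy,
      Finset.sum_eq_single ρ, hu1, one_mul] at hn2
    · exact_mod_cast hn2.symm
    · intro ρ' _ hne
      by_cases h : ρ'.1 ≤ σ
      · rw [hu0 ρ' h hne, zero_mul]
      · rw [h0 ρ' h, Nat.cast_zero, mul_zero]
    · exact fun h => absurd (Finset.mem_univ _) h
  · rw [pullbackMultiplicity_eq_zero f hρ hyσ, h0 ρ hρ, Nat.cast_zero]

end DivisorData

section Attached

variable {Y : NormalVariety} {f : Y.scheme ⟶ Δ.toricVariety} {P : DivisorData Δ Y}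

lemma IsAttached.genericPoint_mem (h : IsAttached f P) : f (genericPoint Y.scheme) ∈ Δ.torus := by
  obtain ⟨-, hc, -⟩ := h
  exact (SetLike.ext_iff.1 hc _).1 (genericPoint_mem_complement P.D)

lemma IsAttached.isPullback (h : IsAttached f P) : IsPullback f P.D := h.1

/-- The pull-back to the function field recovers `ε`. -/
lemma IsAttached.pullFunction_eq (h : IsAttached f P) (hs : f ≫ Δ.toSpec = Y.toSpec) :
    pullFunction f h.genericPoint_mem = P.functionHom := by
  refine torusRing_hom_ext (fun c => ?_) fun m => ?_
  · rw [pullFunction_algebraMap, P.functionHom_algebraMap, hs]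
  · obtain ⟨hc, hε⟩ := h.2
    rw [P.functionHom_torusElement, ← germToFunctionField_pullComplement h.genericPoint_mem P.D hc]
    exact congrArg (Y.scheme.germToFunctionField (complement P.D)) (hε m).symm

/-- A pair is attached to at most one morphism. -/
lemma IsAttached.hom_unique {g : Y.scheme ⟶ Δ.toricVariety} (hf : IsAttached f P)
    (hg : IsAttached g P) (hsf : f ≫ Δ.toSpec = Y.toSpec) (hsg : g ≫ Δ.toSpec = Y.toSpec) :
    f = g := by
  refine hom_eq_of_pullFunction_eq hf.genericPoint_mem hg.genericPoint_mem (fun σ => ?_)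
    ((hf.pullFunction_eq hsf).trans (hg.pullFunction_eq hsg).symm)
  ext y
  exact (hf.isPullback.mem_chartOpens_iff hf.genericPoint_mem σ y).trans
    (hg.isPullback.mem_chartOpens_iff hg.genericPoint_mem σ y).symm

/-- A morphism has at most one attached pair. -/
lemma IsAttached.data_unique {P' : DivisorData Δ Y} (h : IsAttached f P) (h' : IsAttached f P') :
    P = P' := by
  have hD : P.D = P'.D := by
    funext ρ
    refine EffectiveWeilDivisor.ext (DFunLike.ext _ _ fun y => ?_)
    by_cases hy : Order.coheight y = 1
    · exact_mod_cast (h.1 ρ y hy).symm.trans (h'.1 ρ y hy)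
    · have h1 := fun hne => hy ((P.D ρ).codim_one y hne)
      have h2 := fun hne => hy ((P'.D ρ).codim_one y hne)
      rw [not_ne_iff.1 h1, not_ne_iff.1 h2]
  obtain ⟨-, hc, hε⟩ := h
  obtain ⟨-, hc', hε'⟩ := h'
  obtain ⟨D, hint, ε, hdiv⟩ := P
  obtain ⟨D', hint', ε', hdiv'⟩ := P'
  obtain rfl : D = D' := hD
  have : ε = ε' := by
    refine MonoidHom.ext fun m => Units.ext ?_
    exact (hε m.toAdd).trans (hε' m.toAdd).symm
  subst this
  rfl

/-- Every pair is attached to a morphism. -/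
lemma DivisorData.exists_hom (P : DivisorData Δ Y) :
    ∃ f : Y.scheme ⟶ Δ.toricVariety, f ≫ Δ.toSpec = Y.toSpec ∧ IsAttached f P := by
  obtain ⟨f, hV, hfun⟩ := exists_hom_of_functions P.functionHom (regularLocus P.D)
    P.genericPoint_mem_regularLocus P.exists_mem_regularLocus (regularLocus_inf_le P.D)
    fun σ y hy a => P.functionHom_mem_range hy a
  have hη : f (genericPoint Y.scheme) ∈ Δ.torus :=
    hV Δ.zeroCone (P.genericPoint_mem_regularLocus _)
  have hf := hfun hη
  have hD := P.isPullback_of_pullFunction_eq hV hη hf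
  have hc := hD.complement_eq hη
  refine ⟨f, constFunction_injective (RingHom.ext fun c => ?_), hD, hc, fun m => ?_⟩
  · rw [← pullFunction_algebraMap hη, hf, P.functionHom_algebraMap]
  · apply Scheme.germToFunctionField_injective Y.scheme (complement P.D)
    have h1 := germToFunctionField_pullComplement hη P.D hc (Δ.torusElement m)
    rw [hf, P.functionHom_torusElement] at h1
    exact h1.symm

end Attached

section BasePoint

variable {Y : NormalVariety} {f : Y.scheme ⟶ Δ.toricVariety} {P : DivisorData Δ Y}

lemma identityPoint_eq : Δ.identityPoint = Δ.chartMap Δ.zeroCone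
    (PrimeSpectrum.comap Δ.augmentation (IsLocalRing.closedPoint ℂ)) := rfl

lemma identityPoint_mem_torus : Δ.identityPoint ∈ Δ.torus := by
  rw [identityPoint_eq]
  exact chartMap_mem_chartOpens _ _

lemma germ_pullComplement {D : Δ.Ray → EffectiveWeilDivisor Y.scheme}
    (h : complement D = f ⁻¹ᵁ Δ.torus) {y : Y.scheme} (hy : y ∈ complement D)
    (hy' : f y ∈ Δ.torus) (a : coneRing Δ.zeroCone.1) :
    Y.scheme.presheaf.germ (complement D) y hy (pullComplement D h a) =
      pullGerm f Δ.zeroCone y hy' a := by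
  change Y.scheme.presheaf.germ _ _ _ (Y.scheme.presheaf.map (eqToHom h).op _) = _
  rw [TopCat.Presheaf.germ_res_apply]
  exact germ_app_chartFunction f Δ.zeroCone y hy' a

/-- A point maps to `1 ∈ T` if and only if all characters pull back to functions with the value `1`
there. -/
lemma eq_identityPoint_iff {Y : Scheme.{0}} {f : Y ⟶ Δ.toricVariety} {y : Y}
    (hy : f y ∈ Δ.torus) :
    f y = Δ.identityPoint ↔
      ∀ m, Y.residue y (pullGerm f Δ.zeroCone y hy (Δ.torusElement m)) = 1 := by
  let χ : coneRing Δ.zeroCone.1 →+* Y.residueField y :=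
    (Y.residue y).hom.comp (pullGerm f Δ.zeroCone y hy)
  obtain ⟨p, hp⟩ := mem_chartOpens.1 hy
  have hχ : ∀ a, a ∈ p.asIdeal ↔ χ a = 0 := by
    intro a
    have h2 : IsUnit (pullGerm f Δ.zeroCone y hy a) ↔ a ∉ p.asIdeal := by
      refine (isUnit_pullGerm_iff f Δ.zeroCone y hy a).trans ?_
      have h1 : ∀ x (hx : x ∈ Δ.chartOpens Δ.zeroCone), Δ.chartMap Δ.zeroCone p = x →
          (IsUnit (Δ.toricVariety.presheaf.germ (Δ.chartOpens Δ.zeroCone) x hx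
            (Δ.chartFunction Δ.zeroCone a)) ↔ a ∉ p.asIdeal) := by
        rintro _ hx rfl
        exact isUnit_germ_chartFunction_iff Δ.zeroCone a p hx
      exact h1 _ hy hp
    rw [← not_iff_not, ← h2]
    change _ ↔ ¬ IsLocalRing.residue _ _ = 0
    rw [IsLocalRing.residue_eq_zero_iff, IsLocalRing.mem_maximalIdeal, mem_nonunits_iff, not_not]
  have haug : ∀ a, a ∈ (PrimeSpectrum.comap Δ.augmentation (IsLocalRing.closedPoint ℂ)).asIdeal ↔
      Δ.augmentation a = 0 := by
    intro a
    change Δ.augmentation a ∈ IsLocalRing.maximalIdeal ℂ ↔ _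
    rw [IsLocalRing.mem_maximalIdeal, mem_nonunits_iff, isUnit_iff_ne_zero, not_not]
  rw [← hp, identityPoint_eq, (isOpenEmbedding_chartMap Δ.zeroCone).injective.eq_iff]
  constructor
  · rintro rfl m
    have h1 : χ (Δ.torusElement m - 1) = 0 := by
      rw [← hχ, haug, map_sub, augmentation_torusElement, map_one, sub_self]
    rw [map_sub, map_one, sub_eq_zero] at h1
    exact h1
  · intro h
    -- Then `χ` is the augmentation followed by the inclusion of the constants.
    have h1 : χ = (χ.comp (algebraMap ℂ _)).comp Δ.augmentation := by
      refine torusRing_hom_ext (fun c => ?_) fun m => ?_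
      · exact congrArg (χ.comp (algebraMap ℂ _)) (augmentation_algebraMap c).symm
      · refine (h m).trans ?_
        refine Eq.trans ?_ (congrArg (χ.comp (algebraMap ℂ _)) (augmentation_torusElement m).symm)
        exact (map_one _).symm
    refine PrimeSpectrum.ext (Ideal.ext fun a => ?_)
    rw [hχ, haug, h1, RingHom.comp_apply, map_eq_zero]

/-- The base point conditions on morphisms and on pairs correspond to each other. -/
lemma IsAttached.isOneAt_iff (h : IsAttached f P) (y₀ : Y.scheme) :
    P.IsOneAt y₀ ↔ f y₀ = Δ.identityPoint := by
  obtain ⟨-, hc, hε⟩ := h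
  have hmem : y₀ ∈ complement P.D ↔ f y₀ ∈ Δ.torus := SetLike.ext_iff.1 hc y₀
  have hval : ∀ (hy : y₀ ∈ complement P.D) (m : Module.Dual ℤ N),
      Y.scheme.evaluation (complement P.D) y₀ hy
        (P.ε (Multiplicative.ofAdd m) : Γ(Y.scheme, complement P.D)) =
      Y.scheme.residue y₀ (pullGerm f Δ.zeroCone y₀ (hmem.1 hy) (Δ.torusElement m)) := by
    intro hy m
    rw [← germ_pullComplement hc hy]
    exact congrArg (Y.scheme.evaluation (complement P.D) y₀ hy) (hε m)
  constructor
  · rintro ⟨hy, h1⟩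
    exact (eq_identityPoint_iff (hmem.1 hy)).2 fun m => (hval hy m).symm.trans (h1 m)
  · intro hf
    have hy : f y₀ ∈ Δ.torus := hf ▸ identityPoint_mem_torus
    exact ⟨hmem.2 hy, fun m => (hval _ m).trans ((eq_identityPoint_iff hy).1 hf m)⟩

lemma exists_isAttached_of_eq_identityPoint {y₀ : Y.scheme} (hf : f y₀ = Δ.identityPoint) :
    ∃ P : DivisorData Δ Y, IsAttached f P :=
  exists_isAttached (((genericPoint_specializes y₀).map f.continuous).mem_open Δ.torus.isOpen
    (hf ▸ identityPoint_mem_torus : f y₀ ∈ Δ.torus))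

end BasePoint

end SmoothToric

end

theorem corollary2p2 {N : Type} [AddCommGroup N] [Module.Free ℤ N] [Module.Finite ℤ N]
    (Δ : SmoothToric.SmoothFan N) (Y : SmoothToric.NormalVariety) (y₀ : Y.scheme) :
    ∃ Φ : {f : Y.scheme ⟶ Δ.toricVariety // f ≫ Δ.toSpec = Y.toSpec ∧ f y₀ = Δ.identityPoint} ≃
        {P : SmoothToric.DivisorData Δ Y // P.IsOneAt y₀},
      ∀ f, SmoothToric.IsAttached f.1 (Φ f).1 := by
  have hex (f : {f : Y.scheme ⟶ Δ.toricVariety //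
      f ≫ Δ.toSpec = Y.toSpec ∧ f y₀ = Δ.identityPoint}) :
      ∃ P : {P : SmoothToric.DivisorData Δ Y // P.IsOneAt y₀},
        SmoothToric.IsAttached f.1 P.1 := by
    obtain ⟨P, hP⟩ := SmoothToric.exists_isAttached_of_eq_identityPoint f.2.2
    exact ⟨⟨P, (hP.isOneAt_iff y₀).2 f.2.2⟩, hP⟩
  choose Φ hΦ using hex
  refine ⟨Equiv.ofBijective Φ ⟨fun f g hfg => ?_, fun P => ?_⟩, hΦ⟩
  · have hg := hΦ g
    rw [← hfg] at hg
    exact Subtype.ext ((hΦ f).hom_unique hg f.2.1 g.2.1)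
  · obtain ⟨f, hs, hf⟩ := P.1.exists_hom
    let f' : {f : Y.scheme ⟶ Δ.toricVariety //
        f ≫ Δ.toSpec = Y.toSpec ∧ f y₀ = Δ.identityPoint} :=
      ⟨f, hs, (hf.isOneAt_iff y₀).1 P.2⟩
    exact ⟨f', Subtype.ext ((hΦ f').data_unique hf)⟩
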